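/- Let $(\mathcal S,\mathcal A,\mathcal P,r,\gamma)$ be a Markov decision process with finite state and action sets, transition probabilities $\mathcal P(s'\mid s,a)$, rewards $r(s,a,s')$ with $|r(s,a,s')|\le r_{\max}$, and discount factor $\gamma\in(0,1)$. Let $\mu$ be a stationary policy whose state transition matrix $P(s,s')=\sum_a\mu(s,a)\mathcal P(s'\mid s,a)$ is irreducible and aperiodic, with stationary distribution $\pi$, and let $m>0$, $\rho\in(0,1)$ satisfy $\sup_s d_{\rm TV}(P^t(s,\cdot),\pi)\le m\rho^t$ for all $t\ge 0$. Let $(s_t,a_t)_{t\ge0}$ be a sample path of the process under $\mu$ with $s_0\sim\pi$. Let $\phi(s)\in\mathbb R^K$, $s\in\mathcal S$, be feature vectors with $\|\phi(s)\|_2\le 1$ such that the matrix $\Phi$ with rows $\phi(s)^T$ has full column rank, and put $V_\theta=\Phi\theta$. Fix $\lambda\in[0,1]$, let $R^\mu(s)=\sum_{s',a}\mu(s,a)\mathcal P(s'\mid s,a)r(s,a,s')$, $D={\rm diag}(\pi)$, and $$T^{(\lambda)}J=(1-\lambda)\sum_{k=0}^\infty\lambda^k\Big(\sum_{t=0}^k\gamma^tP^tR^\mu+\gamma^{k+1}P^{k+1}J\Big)$$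 (for $\lambda=1$: $T^{(1)}J=\sum_{t\ge0}\gamma^tP^tR^\mu$). Let $\theta_\lambda^*$ be the TD($\lambda$) fixed point, i.e. $\Phi^TD\big(T^{(\lambda)}(\Phi\theta_\lambda^*)-\Phi\theta_\lambda^*\big)=0$. Let $\Theta_\lambda\subset\mathbb R^K$ be a convex set containing $\theta_\lambda^*$, all of whose elements have Euclidean norm at most $R_\lambda$. Let $T\ge1$, let $\theta_0\in\Theta_\lambda$ be deterministic, and let $(\theta_t)$ be generated by projected TD($\lambda$): $$\theta_{t+1}={\rm Proj}_{\Theta_\lambda}(\theta_t+\alpha_t\delta_tz_t),\quad \delta_t=r(s_t,a_t,s_{t+1})+\gamma V_{\theta_t}(s_{t+1})-V_{\theta_t}(s_t),\quad z_t=\sum_{k=0}^t(\gamma\lambda)^k\phi(s_{t-k}),$$ with $\alpha_0=\dots=\alpha_T=1/\sqrt T$. Put $\bar\theta_T=\frac1T\sum_{t=0}^{T-1}\theta_t$, $\kappa=(1-\lambda)/(1-\gamma\lambda)$, $\|V\|_D^2=\sum_s\pi_sV(s)^2$, $\|V\|_{{\rm Dir},k}^2=\frac12\sum_{s,s'}\pi_sP^k(s,s')(V(s')-V(s))^2$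 and $$f^{(\lambda)}(\theta)=(1-\gamma\kappa)\|V_\theta-V_{\theta_\lambda^*}\|_D^2+(1-\lambda)\sum_{k=0}^\infty\lambda^k\gamma^{k+1}\|V_\theta-V_{\theta_\lambda^*}\|_{{\rm Dir},k+1}^2 .$$ Then $$E\big[f^{(\lambda)}(\bar\theta_T)\big]\le\frac{\|\theta_\lambda^*-\theta_0\|_2^2+G_\lambda^2\big[14+28\,\tau_\lambda^{\rm mix}(1/\sqrt T)\big]}{2\sqrt T},$$ where $G_\lambda=(r_{\max}+2R_\lambda)/(1-\gamma\lambda)$ and $\tau_\lambda^{\rm mix}(\epsilon)=\max\big\{\min\{t\in\mathbb N_0: m\rho^t\le\epsilon\},\ \min\{t\in\mathbb N_0:(\gamma\lambda)^t\le\epsilon\}\big\}$. -/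

import Mathlib

open MeasureTheory

noncomputable section

namespace TDLambda

/-- A finite discounted Markov decision process: `trans s a s'` is the probability of moving from
`s` to `s'` under the action `a`, and `reward s a s'` is the deterministic reward. -/
structure MDP (𝒮 𝒜 : Type*) [Fintype 𝒮] where
  trans : 𝒮 → 𝒜 → 𝒮 → ℝ
  trans_nonneg : ∀ s a s', 0 ≤ trans s a s'
  trans_sum : ∀ s a, ∑ s', trans s a s' = 1
  reward : 𝒮 → 𝒜 → 𝒮 → ℝ
  discount : ℝ
  discount_pos : 0 < discount
  discount_lt_one : discount < 1

/-- A stationary randomized policy: `prob s a` is the probability of choosing `a` in state `s`. -/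
structure Policy (𝒮 𝒜 : Type*) [Fintype 𝒜] where
  prob : 𝒮 → 𝒜 → ℝ
  prob_nonneg : ∀ s a, 0 ≤ prob s a
  prob_sum : ∀ s, ∑ a, prob s a = 1

section Chain

variable {𝒮 𝒜 : Type*} [Fintype 𝒮] [Fintype 𝒜]

/-- The transition matrix of the state process under the policy `μ`. -/
def transMatrix (M : MDP 𝒮 𝒜) (μ : Policy 𝒮 𝒜) : Matrix 𝒮 𝒮 ℝ :=
  Matrix.of fun s s' => ∑ a, μ.prob s a * M.trans s a s'

/-- The expected immediate reward in each state under the policy `μ`. -/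
def rewardVec (M : MDP 𝒮 𝒜) (μ : Policy 𝒮 𝒜) : 𝒮 → ℝ :=
  fun s => ∑ s', ∑ a, μ.prob s a * M.trans s a s' * M.reward s a s'

/-- Every state has period one: the only common divisor of its return times is `1`. -/
def IsAperiodic [DecidableEq 𝒮] (P : Matrix 𝒮 𝒮 ℝ) : Prop :=
  ∀ (s : 𝒮) (d : ℕ), (∀ t : ℕ, 0 < t → 0 < (P ^ t) s s → d ∣ t) → d = 1

/-- `π` is a stationary probability distribution of the transition matrix `P`. -/
structure IsStationary (P : Matrix 𝒮 𝒮 ℝ) (π : 𝒮 → ℝ) : Prop where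
  nonneg : ∀ s, 0 ≤ π s
  sum_eq_one : ∑ s, π s = 1
  invariant : ∀ s', ∑ s, π s * P s s' = π s'

/-- Total variation distance of two probability vectors on a finite set. -/
def tvDist (p q : 𝒮 → ℝ) : ℝ := (1 / 2) * ∑ s, |p s - q s|

/-- Uniform geometric mixing with constants `m` and `ρ`. -/
def IsMixing [DecidableEq 𝒮] (P : Matrix 𝒮 𝒮 ℝ) (π : 𝒮 → ℝ) (m ρ : ℝ) : Prop :=
  ∀ (t : ℕ) (s : 𝒮), tvDist (fun s' => (P ^ t) s s') π ≤ m * ρ ^ t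

/-- The squared norm `‖V‖_D²`, with `D` the diagonal matrix of `π`. -/
def normDSq (π : 𝒮 → ℝ) (V : 𝒮 → ℝ) : ℝ := ∑ s, π s * V s ^ 2

/-- The squared `k`-step Dirichlet seminorm `‖V‖²_{Dir,k}`. -/
def dirSq [DecidableEq 𝒮] (P : Matrix 𝒮 𝒮 ℝ) (π : 𝒮 → ℝ) (k : ℕ) (V : 𝒮 → ℝ) : ℝ :=
  (1 / 2) * ∑ s, ∑ s', π s * (P ^ k) s s' * (V s' - V s) ^ 2

/-- `(S, A)` is the state-action sample path of the decision process under the policy `μ`, with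
the initial state distributed according to `π`: the finite-dimensional distributions are
`π(s₀) ∏_{i<t} μ(s_i,a_i) 𝒫(s_{i+1} | s_i,a_i)`. -/
structure IsTrajectory [MeasurableSpace 𝒮] [MeasurableSpace 𝒜] {Ω : Type*} [MeasurableSpace Ω]
    (Pr : Measure Ω) (M : MDP 𝒮 𝒜) (μ : Policy 𝒮 𝒜) (π : 𝒮 → ℝ)
    (S : ℕ → Ω → 𝒮) (A : ℕ → Ω → 𝒜) : Prop where
  measurable_state : ∀ t, Measurable (S t)
  measurable_action : ∀ t, Measurable (A t)
  law : ∀ (t : ℕ) (s : ℕ → 𝒮) (a : ℕ → 𝒜),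
    Pr.real {ω | (∀ i ≤ t, S i ω = s i) ∧ ∀ i < t, A i ω = a i} =
      π (s 0) * ∏ i ∈ Finset.range t, (μ.prob (s i) (a i) * M.trans (s i) (a i) (s (i + 1)))

end Chain

section Approximation

variable {𝒮 𝒜 : Type*} [Fintype 𝒮] [Fintype 𝒜] {K : ℕ}

/-- The linear value function `V_θ(s) = ∑ l, θ_l φ_l(s)`. -/
def valueApprox (φ : 𝒮 → EuclideanSpace ℝ (Fin K)) (θ : EuclideanSpace ℝ (Fin K)) : 𝒮 → ℝ :=
  fun s => ∑ l, θ l * φ s l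

/-- The features are linearly independent, and each feature vector `φ(s)` has norm at most one. -/
structure FeatureAssumption (φ : 𝒮 → EuclideanSpace ℝ (Fin K)) : Prop where
  linearIndependent : LinearIndependent ℝ (fun (l : Fin K) (s : 𝒮) => φ s l)
  norm_sq_le_one : ∀ s, ‖φ s‖ ^ 2 ≤ 1

/-- The operator `T^(λ)`. For `λ = 1` the weighted average over `m` is read, as usual, as its limit
for `λ → 1`, the full discounted return `∑ t, γ^t P^t R`. -/
def bellmanLambda [DecidableEq 𝒮] (M : MDP 𝒮 𝒜) (μ : Policy 𝒮 𝒜) (lam : ℝ) (J : 𝒮 → ℝ) : 𝒮 → ℝ :=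
  fun s =>
    if lam = 1 then
      ∑' t : ℕ, M.discount ^ t * ((transMatrix M μ) ^ t).mulVec (rewardVec M μ) s
    else
      (1 - lam) * ∑' m : ℕ, lam ^ m *
        ((∑ t ∈ Finset.range (m + 1),
            M.discount ^ t * ((transMatrix M μ) ^ t).mulVec (rewardVec M μ) s) +
          M.discount ^ (m + 1) * ((transMatrix M μ) ^ (m + 1)).mulVec J s)

/-- The steady-state mean direction `x̄(θ) = Φᵀ D (T^(λ)(Φθ) - Φθ)` of TD(λ). -/
def meanDirection [DecidableEq 𝒮] (M : MDP 𝒮 𝒜) (μ : Policy 𝒮 𝒜) (π : 𝒮 → ℝ)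
    (φ : 𝒮 → EuclideanSpace ℝ (Fin K)) (lam : ℝ) (θ : EuclideanSpace ℝ (Fin K)) :
    EuclideanSpace ℝ (Fin K) :=
  ∑ s, (π s * (bellmanLambda M μ lam (valueApprox φ θ) s - valueApprox φ θ s)) • φ s

/-- `θ` is the TD(λ) fixed point: `Φθ` is the `D`-orthogonal projection of `T^(λ)(Φθ)` onto the
span of the features, that is, `x̄(θ) = 0`. -/
def IsTDFixedPoint [DecidableEq 𝒮] (M : MDP 𝒮 𝒜) (μ : Policy 𝒮 𝒜) (π : 𝒮 → ℝ)
    (φ : 𝒮 → EuclideanSpace ℝ (Fin K)) (lam : ℝ) (θ : EuclideanSpace ℝ (Fin K)) : Prop :=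
  meanDirection M μ π φ lam θ = 0

/-- `κ = (1-λ)/(1-γλ)`. -/
def kappa (γ lam : ℝ) : ℝ := (1 - lam) / (1 - γ * lam)

/-- The function `f^(λ)`, as a function of `θ`, with minimizer `θstar`:
`(1-γκ) ‖V_θ - V_θ*‖_D² + (1-λ) ∑_{m≥0} λ^m γ^(m+1) ‖V_θ - V_θ*‖²_{Dir,m+1}`.
The series is dominated by a geometric series of ratio `γλ < 1`. -/
def fLambda [DecidableEq 𝒮] (P : Matrix 𝒮 𝒮 ℝ) (π : 𝒮 → ℝ)
    (φ : 𝒮 → EuclideanSpace ℝ (Fin K)) (γ lam : ℝ) (θstar θ : EuclideanSpace ℝ (Fin K)) : ℝ :=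
  (1 - γ * kappa γ lam) * normDSq π (valueApprox φ θ - valueApprox φ θstar) +
    (1 - lam) * ∑' m : ℕ, lam ^ m * γ ^ (m + 1) *
      dirSq P π (m + 1) (valueApprox φ θ - valueApprox φ θstar)

/-- The eligibility trace `z_t = ∑_{k=0}^t (γλ)^k φ(s_{t-k})` along a path of states. -/
def trace (φ : 𝒮 → EuclideanSpace ℝ (Fin K)) (γ lam : ℝ) (s : ℕ → 𝒮) (t : ℕ) :
    EuclideanSpace ℝ (Fin K) :=
  ∑ k ∈ Finset.range (t + 1), (γ * lam) ^ k • φ (s (t - k))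

/-- The temporal-difference error `r(s,a,s') + γ V_θ(s') - V_θ(s)`. -/
def tdError (M : MDP 𝒮 𝒜) (φ : 𝒮 → EuclideanSpace ℝ (Fin K)) (θ : EuclideanSpace ℝ (Fin K))
    (s : 𝒮) (a : 𝒜) (s' : 𝒮) : ℝ :=
  M.reward s a s' + M.discount * valueApprox φ θ s' - valueApprox φ θ s

/-- `p` is the Euclidean projection of `u` onto `C`: a nearest point of `C`. -/
def IsProj (C : Set (EuclideanSpace ℝ (Fin K))) (u p : EuclideanSpace ℝ (Fin K)) : Prop :=
  p ∈ C ∧ ∀ q ∈ C, ‖u - p‖ ≤ ‖u - q‖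

/-- `θ` is generated by projected TD(λ) along the path `(S, A)` with step-sizes `α`, starting at
the deterministic point `θ0` of `C`: almost surely
`θ_{t+1} = Proj_C (θ_t + α_t δ_t z_t)` for all `t`. -/
structure IsProjectedTD {Ω : Type*} [MeasurableSpace Ω] (Pr : Measure Ω) (M : MDP 𝒮 𝒜)
    (φ : 𝒮 → EuclideanSpace ℝ (Fin K)) (lam : ℝ) (C : Set (EuclideanSpace ℝ (Fin K)))
    (α : ℕ → ℝ) (θ0 : EuclideanSpace ℝ (Fin K)) (S : ℕ → Ω → 𝒮) (A : ℕ → Ω → 𝒜)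
    (θ : ℕ → Ω → EuclideanSpace ℝ (Fin K)) : Prop where
  start_mem : θ0 ∈ C
  start : ∀ᵐ ω ∂Pr, θ 0 ω = θ0
  step : ∀ᵐ ω ∂Pr, ∀ t : ℕ,
    IsProj C
      (θ t ω + (α t * tdError M φ (θ t ω) (S t ω) (A t ω) (S (t + 1) ω)) •
        trace φ M.discount lam (fun i => S i ω) t)
      (θ (t + 1) ω)

/-- The running average `(1/T) ∑_{t<T} θ_t`. -/
def average (θ : ℕ → EuclideanSpace ℝ (Fin K)) (T : ℕ) : EuclideanSpace ℝ (Fin K) :=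
  (1 / (T : ℝ)) • ∑ t ∈ Finset.range T, θ t

end Approximation

/-- `τ^MC(ε) = min {t ∈ ℕ₀ | m ρ^t ≤ ε}`. -/
def tauMC (m ρ ε : ℝ) : ℕ := sInf {t : ℕ | m * ρ ^ t ≤ ε}

/-- `τ^Algo(ε) = min {t ∈ ℕ₀ | (γλ)^t ≤ ε}`. -/
def tauAlgo (γ lam ε : ℝ) : ℕ := sInf {t : ℕ | (γ * lam) ^ t ≤ ε}

/-- `τ_λ^mix(ε) = max {τ^MC(ε), τ^Algo(ε)}`. -/
def tauMix (m ρ γ lam ε : ℝ) : ℕ := max (tauMC m ρ ε) (tauAlgo γ lam ε)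

/-- `G_λ = (r_max + 2 R_λ) / (1 - γλ)`. -/
def gBound (γ lam rmax R : ℝ) : ℝ := (rmax + 2 * R) / (1 - γ * lam)

end TDLambda

end

/-! The mean TD(λ) direction x̄ splits the gradient of f^(λ): ⟨θ - θ*, x̄(θ)⟩ = -f^(λ)(θ)
(`inner_meanDirection_eq_neg_fLambda`). This rests on T^(λ)J - J = ∑ (γλ)^k P^k (R^μ + γPJ - J)
(`bellmanLambda_sub`) and on stationarity, which turns Dirichlet seminorms into correlations ⟨V, P^k
V⟩_D (`dirSq_eq`). Projecting onto a convex set does not increase the distance to θ*, so expanding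
‖θ_{t+1} - θ*‖² and telescoping with α = 1/√T gives 2α ∑ E f(θ_t) ≤ ‖θ_0 - θ*‖² + Tα²G² + 2α ∑ E⟨θ_t
- θ*, δ_t z_t - x̄(θ_t)⟩ (`IsTrajectory.sum_integral_fLambda_le`), and convexity of f^(λ) passes
from the iterates to their average.

The noise in the last sum is not centred, because θ_t depends on the same path as z_t. With τ the
mixing time at 1/√T and t ≥ 2τ, θ_t is replaced by θ_{t-2τ}: the noise is 6G-Lipschitz in θ and each
step has length at most G/√T, so this costs 12τG²/√T. With the frozen parameter the eligibility
trace is cut after lag τ. The discarded tails cost at most 2G²/√T; the retained lags only see states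
at least τ steps after the freezing time, so mixing leaves at most 2G²/√T
(`IsTrajectory.integral_inner_direction_sub_le`). The first 2τ times are covered by a crude bound.

The given iterates are prescribed only almost surely. They are replaced by `tdIterate`, a function
of the finite history at every sample point, so that every expectation reduces to finite-dimensional
distributions. -/

noncomputable section

namespace TDLambda

open Matrix

/-! ### Stochastic matrices, discounted sums and Dirichlet forms. -/

section Stochastic

variable {𝒮 : Type*} [Fintype 𝒮] {P : Matrix 𝒮 𝒮 ℝ} {π : 𝒮 → ℝ}

lemma abs_sum_mul_le {p v : 𝒮 → ℝ} (hp : ∀ s, 0 ≤ p s) (hs : ∑ s, p s = 1) {B : ℝ}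
    (hv : ∀ s, |v s| ≤ B) : |∑ s, p s * v s| ≤ B := by
  calc |∑ s, p s * v s| ≤ ∑ s, |p s * v s| := Finset.abs_sum_le_sum_abs _ _
    _ ≤ ∑ s, p s * B := Finset.sum_le_sum fun s _ => by
        rw [abs_mul, abs_of_nonneg (hp s)]
        exact mul_le_mul_of_nonneg_left (hv s) (hp s)
    _ = B := by rw [← Finset.sum_mul, hs, one_mul]

lemma exists_abs_le (v : 𝒮 → ℝ) : ∃ B, ∀ s, |v s| ≤ B :=
  ⟨∑ s, |v s|, fun s =>
    Finset.single_le_sum (f := fun s => |v s|) (fun _ _ => abs_nonneg _) (Finset.mem_univ s)⟩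

lemma normDSq_convex (h : IsStationary P π) (V W : 𝒮 → ℝ) {a b : ℝ} (ha : 0 ≤ a) (hb : 0 ≤ b)
    (hab : a + b = 1) :
    normDSq π (a • V + b • W) ≤ a * normDSq π V + b * normDSq π W := by
  simp_rw [normDSq, Finset.mul_sum, ← Finset.sum_add_distrib]
  refine Finset.sum_le_sum fun s _ => ?_
  have := (even_two.convexOn_pow (𝕜 := ℝ)).2 (Set.mem_univ (V s)) (Set.mem_univ (W s)) ha hb hab
  simp only [smul_eq_mul, Pi.add_apply, Pi.smul_apply] at this ⊢
  nlinarith [mul_le_mul_of_nonneg_left this (h.nonneg s)]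

lemma summable_geometric_mul {β : ℝ} (h0 : 0 ≤ β) (h1 : β < 1) {c : ℕ → ℝ} {B : ℝ}
    (hc : ∀ k, |c k| ≤ B) : Summable fun k => β ^ k * c k := by
  refine Summable.of_norm_bounded (g := fun k => β ^ k * B)
    ((summable_geometric_of_lt_one h0 h1).mul_right B) fun k => ?_
  rw [Real.norm_eq_abs, abs_mul, abs_of_nonneg (pow_nonneg h0 k)]
  exact mul_le_mul_of_nonneg_left (hc k) (pow_nonneg h0 k)

lemma abs_tsum_geometric_mul_le {β : ℝ} (h0 : 0 ≤ β) (h1 : β < 1) {c : ℕ → ℝ} {B : ℝ}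
    (hc : ∀ k, |c k| ≤ B) : |∑' k, β ^ k * c k| ≤ B / (1 - β) := by
  have hg := (hasSum_geometric_of_lt_one h0 h1).mul_right B
  rw [inv_mul_eq_div] at hg
  rw [← Real.norm_eq_abs]
  refine tsum_of_norm_bounded hg fun k => ?_
  rw [Real.norm_eq_abs, abs_mul, abs_of_nonneg (pow_nonneg h0 k)]
  exact mul_le_mul_of_nonneg_left (hc k) (pow_nonneg h0 k)

variable [DecidableEq 𝒮]

lemma abs_mulVec_le (hP : P ∈ rowStochastic ℝ 𝒮) {v : 𝒮 → ℝ} {B : ℝ} (hv : ∀ s, |v s| ≤ B)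
    (s : 𝒮) : |(P *ᵥ v) s| ≤ B :=
  abs_sum_mul_le (fun _ => nonneg_of_mem_rowStochastic hP) (sum_row_of_mem_rowStochastic hP s) hv

/-- The discounted sum `∑ k, β^k P^k v`. -/
def discountedSum (P : Matrix 𝒮 𝒮 ℝ) (β : ℝ) (v : 𝒮 → ℝ) (s : 𝒮) : ℝ :=
  ∑' k : ℕ, β ^ k * ((P ^ k) *ᵥ v) s

lemma summable_discounted (hP : P ∈ rowStochastic ℝ 𝒮) {β : ℝ} (h0 : 0 ≤ β) (h1 : β < 1)
    (v : 𝒮 → ℝ) (s : 𝒮) : Summable fun k : ℕ => β ^ k * ((P ^ k) *ᵥ v) s := by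
  obtain ⟨B, hB⟩ := exists_abs_le v
  exact summable_geometric_mul h0 h1 fun k => abs_mulVec_le (pow_mem hP k) hB s

lemma abs_discountedSum_le (hP : P ∈ rowStochastic ℝ 𝒮) {β : ℝ} (h0 : 0 ≤ β) (h1 : β < 1)
    {v : 𝒮 → ℝ} {B : ℝ} (hv : ∀ s, |v s| ≤ B) (s : 𝒮) :
    |discountedSum P β v s| ≤ B / (1 - β) :=
  abs_tsum_geometric_mul_le h0 h1 fun k => abs_mulVec_le (pow_mem hP k) hv s

lemma discountedSum_sub (hP : P ∈ rowStochastic ℝ 𝒮) {β : ℝ} (h0 : 0 ≤ β) (h1 : β < 1)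
    (v w : 𝒮 → ℝ) (s : 𝒮) :
    discountedSum P β (v - w) s = discountedSum P β v s - discountedSum P β w s := by
  rw [discountedSum, discountedSum, discountedSum,
    ← (summable_discounted hP h0 h1 v s).tsum_sub (summable_discounted hP h0 h1 w s)]
  refine tsum_congr fun k => ?_
  rw [mulVec_sub, Pi.sub_apply, mul_sub]

lemma IsStationary.pow (h : IsStationary P π) (k : ℕ) (s' : 𝒮) :
    ∑ s, π s * (P ^ k) s s' = π s' := by
  induction k generalizing s' with
  | zero => simp [Matrix.one_apply]
  | succ k ih =>
    simp_rw [pow_succ, Matrix.mul_apply, Finset.mul_sum, ← mul_assoc]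
    rw [Finset.sum_comm]
    simp_rw [← Finset.sum_mul, ih]
    exact h.invariant s'

/-- The two expectations of `v` differ by at most `B` times the ℓ¹ distance of the laws, which is
twice the total variation distance; hence the factor 2. -/
lemma IsMixing.abs_mulVec_sub_le {m ρ : ℝ} (hmix : IsMixing P π m ρ) {v : 𝒮 → ℝ} {B : ℝ}
    (hB : 0 ≤ B) (hv : ∀ s, |v s| ≤ B) (k : ℕ) (s : 𝒮) :
    |((P ^ k) *ᵥ v) s - ∑ s, π s * v s| ≤ 2 * (m * ρ ^ k) * B := by
  have h := hmix k s
  rw [tvDist] at h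
  have h2 : ((P ^ k) *ᵥ v) s - ∑ s, π s * v s = ∑ s', ((P ^ k) s s' - π s') * v s' := by
    simp [mulVec, dotProduct, sub_mul]
  rw [h2]
  calc |∑ s', ((P ^ k) s s' - π s') * v s'| ≤ ∑ s', |((P ^ k) s s' - π s') * v s'| :=
        Finset.abs_sum_le_sum_abs _ _
    _ ≤ ∑ s', |(P ^ k) s s' - π s'| * B := Finset.sum_le_sum fun s' _ => by
        rw [abs_mul]
        exact mul_le_mul_of_nonneg_left (hv s') (abs_nonneg _)
    _ = (∑ s', |(P ^ k) s s' - π s'|) * B := by rw [Finset.sum_mul]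
    _ ≤ 2 * (m * ρ ^ k) * B := by
        apply mul_le_mul_of_nonneg_right _ hB
        linarith

/-- `‖V‖²_{Dir,k} = ‖V‖_D² - ⟨V, P^k V⟩_D` for a stationary distribution. -/
lemma dirSq_eq (hP : P ∈ rowStochastic ℝ 𝒮) (h : IsStationary P π) (k : ℕ) (V : 𝒮 → ℝ) :
    dirSq P π k V = normDSq π V - ∑ s, π s * (V s * ((P ^ k) *ᵥ V) s) := by
  have h1 : ∑ s, ∑ s', π s * (P ^ k) s s' * V s' ^ 2 = normDSq π V := by
    rw [Finset.sum_comm]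
    simp_rw [← Finset.sum_mul, h.pow]
    rfl
  have h2 : ∑ s, ∑ s', π s * (P ^ k) s s' * V s ^ 2 = normDSq π V := by
    simp_rw [← Finset.sum_mul, ← Finset.mul_sum, sum_row_of_mem_rowStochastic (pow_mem hP k)]
    simp [normDSq]
  have h3 : ∑ s, ∑ s', π s * (P ^ k) s s' * (V s * V s') =
      ∑ s, π s * (V s * ((P ^ k) *ᵥ V) s) := by
    simp_rw [mulVec, dotProduct, Finset.mul_sum]
    refine Finset.sum_congr rfl fun s _ => Finset.sum_congr rfl fun s' _ => by ring
  have h4 : ∑ s, ∑ s', π s * (P ^ k) s s' * (V s' - V s) ^ 2 =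
      ∑ s, ∑ s', π s * (P ^ k) s s' * V s' ^ 2 + ∑ s, ∑ s', π s * (P ^ k) s s' * V s ^ 2
        - 2 * ∑ s, ∑ s', π s * (P ^ k) s s' * (V s * V s') := by
    simp_rw [Finset.mul_sum, ← Finset.sum_add_distrib, ← Finset.sum_sub_distrib]
    refine Finset.sum_congr rfl fun s _ => Finset.sum_congr rfl fun s' _ => by ring
  rw [dirSq, h4, h1, h2, h3]
  ring

lemma dirSq_convex (hP : P ∈ rowStochastic ℝ 𝒮) (h : IsStationary P π) (k : ℕ) (V W : 𝒮 → ℝ)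
    {a b : ℝ} (ha : 0 ≤ a) (hb : 0 ≤ b) (hab : a + b = 1) :
    dirSq P π k (a • V + b • W) ≤ a * dirSq P π k V + b * dirSq P π k W := by
  have key : ∑ s, ∑ s', π s * (P ^ k) s s' * ((a • V + b • W) s' - (a • V + b • W) s) ^ 2 ≤
      ∑ s, ∑ s', (a * (π s * (P ^ k) s s' * (V s' - V s) ^ 2)
        + b * (π s * (P ^ k) s s' * (W s' - W s) ^ 2)) := by
    refine Finset.sum_le_sum fun s _ => Finset.sum_le_sum fun s' _ => ?_
    have := (even_two.convexOn_pow (𝕜 := ℝ)).2 (Set.mem_univ (V s' - V s))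
      (Set.mem_univ (W s' - W s)) ha hb hab
    have hq : 0 ≤ π s * (P ^ k) s s' :=
      mul_nonneg (h.nonneg s) (nonneg_of_mem_rowStochastic (pow_mem hP k))
    simp only [smul_eq_mul, Pi.add_apply, Pi.smul_apply] at this ⊢
    have e : a * V s' + b * W s' - (a * V s + b * W s) =
      a * (V s' - V s) + b * (W s' - W s) := by ring
    rw [e]
    nlinarith [mul_le_mul_of_nonneg_left this hq]
  simp_rw [Finset.sum_add_distrib, ← Finset.mul_sum] at key
  rw [dirSq, dirSq, dirSq]
  linarith

lemma abs_dirSq_le (hP : P ∈ rowStochastic ℝ 𝒮) (h : IsStationary P π) (V : 𝒮 → ℝ) :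
    ∃ B, ∀ k, |dirSq P π k V| ≤ B := by
  obtain ⟨B, hB⟩ := exists_abs_le V
  refine ⟨|normDSq π V| + B * B, fun k => ?_⟩
  rw [dirSq_eq hP h]
  refine (abs_sub _ _).trans (add_le_add le_rfl ?_)
  refine abs_sum_mul_le h.nonneg h.sum_eq_one fun s => ?_
  rw [abs_mul]
  exact mul_le_mul (hB s) (abs_mulVec_le (pow_mem hP k) hB s) (abs_nonneg _)
    ((abs_nonneg _).trans (hB s))

end Stochastic

/-! ### The operator T^(λ) as a discounted sum of one-step errors. -/

section Bellman

variable {𝒮 𝒜 : Type*} [Fintype 𝒮]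

lemma mul_discount_lt_one (M : MDP 𝒮 𝒜) {lam : ℝ} (h1 : lam ≤ 1) :
    M.discount * lam < 1 :=
  (mul_le_of_le_one_right M.discount_pos.le h1).trans_lt M.discount_lt_one

variable [DecidableEq 𝒮] [Fintype 𝒜]

lemma transMatrix_mem_rowStochastic (M : MDP 𝒮 𝒜) (μ : Policy 𝒮 𝒜) :
    transMatrix M μ ∈ rowStochastic ℝ 𝒮 := by
  rw [mem_rowStochastic_iff_sum]
  refine ⟨fun s s' => Finset.sum_nonneg fun a _ =>
    mul_nonneg (μ.prob_nonneg s a) (M.trans_nonneg s a s'), fun s => ?_⟩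
  simp only [transMatrix, of_apply]
  rw [Finset.sum_comm]
  simp_rw [← Finset.mul_sum, M.trans_sum, mul_one, μ.prob_sum]

/-- The expected one-step temporal-difference error `R^μ + γ P J - J`. -/
def bellmanError (M : MDP 𝒮 𝒜) (μ : Policy 𝒮 𝒜) (J : 𝒮 → ℝ) : 𝒮 → ℝ :=
  rewardVec M μ + M.discount • (transMatrix M μ *ᵥ J) - J

lemma pow_mulVec_bellmanError (M : MDP 𝒮 𝒜) (μ : Policy 𝒮 𝒜) (J : 𝒮 → ℝ) (t : ℕ) (s : 𝒮) :
    M.discount ^ t * ((transMatrix M μ ^ t) *ᵥ bellmanError M μ J) s =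
      M.discount ^ t * ((transMatrix M μ ^ t) *ᵥ rewardVec M μ) s +
      (M.discount ^ (t + 1) * ((transMatrix M μ ^ (t + 1)) *ᵥ J) s -
        M.discount ^ t * ((transMatrix M μ ^ t) *ᵥ J) s) := by
  rw [bellmanError, mulVec_sub, mulVec_add, mulVec_smul, mulVec_mulVec, ← pow_succ]
  simp only [Pi.sub_apply, Pi.add_apply, Pi.smul_apply, smul_eq_mul]
  ring

/-- Discounted one-step errors telescope to a multi-step return minus `J`. Averaging these returns
with weights (1 - λ)λ^n changes the discount from γ to γλ. -/
lemma bellmanLambda_sub (M : MDP 𝒮 𝒜) (μ : Policy 𝒮 𝒜) {lam : ℝ} (h0 : 0 ≤ lam)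
    (h1 : lam ≤ 1) (J : 𝒮 → ℝ) (s : 𝒮) :
    bellmanLambda M μ lam J s - J s =
      discountedSum (transMatrix M μ) (M.discount * lam) (bellmanError M μ J) s := by
  have hP := transMatrix_mem_rowStochastic M μ
  set P := transMatrix M μ
  set γ := M.discount
  have hγ0 : 0 ≤ γ := M.discount_pos.le
  have hγ1 : γ < 1 := M.discount_lt_one
  have part : ∀ n, ∑ t ∈ Finset.range n, γ ^ t * ((P ^ t) *ᵥ bellmanError M μ J) s =
      ∑ t ∈ Finset.range n, γ ^ t * ((P ^ t) *ᵥ rewardVec M μ) s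
        + (γ ^ n * ((P ^ n) *ᵥ J) s - J s) := fun n => by
    simp_rw [P, γ, pow_mulVec_bellmanError, Finset.sum_add_distrib,
      Finset.sum_range_sub (fun t => M.discount ^ t * ((transMatrix M μ ^ t) *ᵥ J) s)]
    simp
  rw [discountedSum, bellmanLambda]
  split_ifs with hl
  · subst hl
    simp only [mul_one]
    have hlim : Filter.Tendsto (fun n => γ ^ n * ((P ^ n) *ᵥ J) s) Filter.atTop (nhds 0) :=
      (summable_discounted hP hγ0 hγ1 J s).tendsto_atTop_zero
    have e1 := (summable_discounted hP hγ0 hγ1 (bellmanError M μ J) s).hasSum.tendsto_sum_nat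
    have e2 := (summable_discounted hP hγ0 hγ1 (rewardVec M μ) s).hasSum.tendsto_sum_nat
    simp_rw [part] at e1
    have e3 := e2.add (hlim.sub_const (J s))
    have := tendsto_nhds_unique e1 e3
    rw [this]
    ring
  · have hl1 : lam < 1 := lt_of_le_of_ne h1 hl
    have hb1 : γ * lam < 1 := mul_discount_lt_one M h1
    have hb0 : 0 ≤ γ * lam := mul_nonneg hγ0 h0
    have hs := summable_discounted hP hb0 hb1 (bellmanError M μ J) s
    have hg := summable_geometric_of_lt_one h0 hl1
    -- Cauchy product with ∑ λ^n = 1/(1 - λ): by `part`, its n-th coefficient is λ^n times the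
    -- (n+1)-step return minus `J`.
    have hprod := tsum_mul_tsum_eq_tsum_sum_range_of_summable_norm hs.norm hg.norm
    have hsp := summable_norm_sum_mul_range_of_summable_norm hs.norm hg.norm
    have e : ∀ n, ∑ k ∈ Finset.range (n + 1),
        (γ * lam) ^ k * ((P ^ k) *ᵥ bellmanError M μ J) s * lam ^ (n - k) =
        lam ^ n * ((∑ t ∈ Finset.range (n + 1), γ ^ t * ((P ^ t) *ᵥ rewardVec M μ) s) +
          γ ^ (n + 1) * ((P ^ (n + 1)) *ᵥ J) s) - lam ^ n * J s := fun n => by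
      rw [← mul_sub, add_sub_assoc, ← part, Finset.mul_sum]
      refine Finset.sum_congr rfl fun k hk => ?_
      have : k + (n - k) = n := by
        have := Finset.mem_range.1 hk
        omega
      have h2 : lam ^ n = lam ^ k * lam ^ (n - k) := by rw [← pow_add, this]
      rw [h2, mul_pow]
      ring
    simp_rw [e] at hprod hsp
    have hsJ : Summable fun n => lam ^ n * J s := hg.mul_right _
    have hs2 := hsp.of_norm.add hsJ
    simp only [sub_add_cancel] at hs2
    rw [hs2.tsum_sub hsJ, tsum_mul_right, tsum_geometric_of_lt_one h0 hl1] at hprod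
    have hne : (1 - lam) ≠ 0 := by linarith
    field_simp at hprod
    linarith

end Bellman

/-! ### Linear value functions and Φᵀ D v. -/

section Features

variable {𝒮 𝒜 : Type*} {K : ℕ}

lemma valueApprox_eq_inner (φ : 𝒮 → EuclideanSpace ℝ (Fin K)) (θ : EuclideanSpace ℝ (Fin K))
    (s : 𝒮) : valueApprox φ θ s = inner ℝ θ (φ s) := by
  simp [valueApprox, PiLp.inner_apply, mul_comm]

lemma valueApprox_sub (φ : 𝒮 → EuclideanSpace ℝ (Fin K)) (θ θ' : EuclideanSpace ℝ (Fin K)) :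
    valueApprox φ (θ - θ') = valueApprox φ θ - valueApprox φ θ' := by
  ext s
  simp [valueApprox_eq_inner, inner_sub_left]

lemma FeatureAssumption.norm_le_one [Fintype 𝒮] {φ : 𝒮 → EuclideanSpace ℝ (Fin K)}
    (hφ : FeatureAssumption φ) (s : 𝒮) : ‖φ s‖ ≤ 1 := by
  have := hφ.norm_sq_le_one s
  nlinarith [norm_nonneg (φ s)]

lemma FeatureAssumption.abs_valueApprox_le [Fintype 𝒮] {φ : 𝒮 → EuclideanSpace ℝ (Fin K)}
    (hφ : FeatureAssumption φ) (θ : EuclideanSpace ℝ (Fin K)) (s : 𝒮) :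
    |valueApprox φ θ s| ≤ ‖θ‖ := by
  rw [valueApprox_eq_inner]
  exact (abs_real_inner_le_norm _ _).trans
    (mul_le_of_le_one_right (norm_nonneg _) (hφ.norm_le_one s))

/-- The feature vector `Φᵀ D v`. -/
def featureMean [Fintype 𝒮] (π : 𝒮 → ℝ) (φ : 𝒮 → EuclideanSpace ℝ (Fin K)) (v : 𝒮 → ℝ) :
    EuclideanSpace ℝ (Fin K) :=
  ∑ s, (π s * v s) • φ s

lemma inner_featureMean [Fintype 𝒮] (π : 𝒮 → ℝ) (φ : 𝒮 → EuclideanSpace ℝ (Fin K))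
    (v : 𝒮 → ℝ) (w : EuclideanSpace ℝ (Fin K)) :
    inner ℝ w (featureMean π φ v) = ∑ s, π s * (valueApprox φ w s * v s) := by
  simp_rw [featureMean, inner_sum, inner_smul_right, valueApprox_eq_inner]
  exact Finset.sum_congr rfl fun s _ => by ring

lemma norm_featureMean_le [Fintype 𝒮] {π : 𝒮 → ℝ} (h0 : ∀ s, 0 ≤ π s) (h1 : ∑ s, π s = 1)
    {φ : 𝒮 → EuclideanSpace ℝ (Fin K)} (hφ : FeatureAssumption φ) {v : 𝒮 → ℝ} {B : ℝ}
    (hv : ∀ s, |v s| ≤ B) : ‖featureMean π φ v‖ ≤ B := by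
  calc ‖featureMean π φ v‖ ≤ ∑ s, ‖(π s * v s) • φ s‖ := norm_sum_le _ _
    _ ≤ ∑ s, π s * B := Finset.sum_le_sum fun s _ => by
        rw [norm_smul, norm_mul, Real.norm_eq_abs, Real.norm_eq_abs, abs_of_nonneg (h0 s),
          mul_assoc]
        refine mul_le_mul_of_nonneg_left ?_ (h0 s)
        exact (mul_le_of_le_one_right (abs_nonneg _) (hφ.norm_le_one s)).trans (hv s)
    _ = B := by rw [← Finset.sum_mul, h1, one_mul]

end Features

/-! ### The mean direction, gradient splitting and convexity of f^(λ). -/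

section MeanDirection

lemma bellmanError_sub {𝒮 𝒜 : Type*} [Fintype 𝒮] [Fintype 𝒜] (M : MDP 𝒮 𝒜) (μ : Policy 𝒮 𝒜) (J J' : 𝒮 → ℝ) :
    bellmanError M μ J - bellmanError M μ J' =
      M.discount • (transMatrix M μ *ᵥ (J - J')) - (J - J') := by
  rw [bellmanError, bellmanError, mulVec_sub, smul_sub]
  abel

variable {𝒮 𝒜 : Type*} [Fintype 𝒮] [DecidableEq 𝒮] [Fintype 𝒜] {K : ℕ}
  {M : MDP 𝒮 𝒜} {μ : Policy 𝒮 𝒜} {π : 𝒮 → ℝ} {φ : 𝒮 → EuclideanSpace ℝ (Fin K)} {lam : ℝ}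

lemma meanDirection_eq (M : MDP 𝒮 𝒜) (μ : Policy 𝒮 𝒜) (π : 𝒮 → ℝ)
    (φ : 𝒮 → EuclideanSpace ℝ (Fin K)) (h0 : 0 ≤ lam) (h1 : lam ≤ 1)
    (θ : EuclideanSpace ℝ (Fin K)) :
    meanDirection M μ π φ lam θ = featureMean π φ
      (discountedSum (transMatrix M μ) (M.discount * lam) (bellmanError M μ (valueApprox φ θ))) := by
  simp_rw [meanDirection, bellmanLambda_sub M μ h0 h1]
  rfl

lemma abs_bellmanError_sub_le (hφ : FeatureAssumption φ) (θ θ' : EuclideanSpace ℝ (Fin K))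
    (s : 𝒮) :
    |(bellmanError M μ (valueApprox φ θ) - bellmanError M μ (valueApprox φ θ')) s| ≤
      2 * ‖θ - θ'‖ := by
  rw [bellmanError_sub, ← valueApprox_sub]
  have h1 := abs_mulVec_le (transMatrix_mem_rowStochastic M μ)
    (hφ.abs_valueApprox_le (θ - θ')) s
  have h2 := hφ.abs_valueApprox_le (θ - θ') s
  simp only [Pi.sub_apply, Pi.smul_apply, smul_eq_mul]
  refine (abs_sub _ _).trans ?_
  rw [abs_mul, abs_of_pos M.discount_pos]
  have h3 := mul_le_of_le_one_left (abs_nonneg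
    ((transMatrix M μ *ᵥ valueApprox φ (θ - θ')) s)) M.discount_lt_one.le
  linarith

lemma meanDirection_sub (M : MDP 𝒮 𝒜) (μ : Policy 𝒮 𝒜) (π : 𝒮 → ℝ)
    (φ : 𝒮 → EuclideanSpace ℝ (Fin K)) (h0 : 0 ≤ lam) (h1 : lam ≤ 1)
    (θ θ' : EuclideanSpace ℝ (Fin K)) :
    meanDirection M μ π φ lam θ - meanDirection M μ π φ lam θ' = featureMean π φ
      (discountedSum (transMatrix M μ) (M.discount * lam)
        (bellmanError M μ (valueApprox φ θ) - bellmanError M μ (valueApprox φ θ'))) := by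
  rw [meanDirection_eq M μ π φ h0 h1, meanDirection_eq M μ π φ h0 h1, featureMean, featureMean,
    featureMean, ← Finset.sum_sub_distrib]
  refine Finset.sum_congr rfl fun s _ => ?_
  rw [discountedSum_sub (transMatrix_mem_rowStochastic M μ) (mul_nonneg M.discount_pos.le h0)
    (mul_discount_lt_one M h1), mul_sub, sub_smul]

lemma norm_meanDirection_sub_le (hπ : IsStationary (transMatrix M μ) π)
    (hφ : FeatureAssumption φ) (h0 : 0 ≤ lam) (h1 : lam ≤ 1)
    (θ θ' : EuclideanSpace ℝ (Fin K)) :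
    ‖meanDirection M μ π φ lam θ - meanDirection M μ π φ lam θ'‖ ≤
      2 * ‖θ - θ'‖ / (1 - M.discount * lam) := by
  rw [meanDirection_sub M μ π φ h0 h1]
  exact norm_featureMean_le hπ.nonneg hπ.sum_eq_one hφ
    (abs_discountedSum_le (transMatrix_mem_rowStochastic M μ) (mul_nonneg M.discount_pos.le h0)
      (mul_discount_lt_one M h1) (abs_bellmanError_sub_le hφ θ θ'))

lemma norm_meanDirection_le (hπ : IsStationary (transMatrix M μ) π)
    (hφ : FeatureAssumption φ) (h0 : 0 ≤ lam) (h1 : lam ≤ 1) {B : ℝ}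
    {θ : EuclideanSpace ℝ (Fin K)} (hB : ∀ s, |bellmanError M μ (valueApprox φ θ) s| ≤ B) :
    ‖meanDirection M μ π φ lam θ‖ ≤ B / (1 - M.discount * lam) := by
  rw [meanDirection_eq M μ π φ h0 h1]
  exact norm_featureMean_le hπ.nonneg hπ.sum_eq_one hφ
    (abs_discountedSum_le (transMatrix_mem_rowStochastic M μ) (mul_nonneg M.discount_pos.le h0)
      (mul_discount_lt_one M h1) hB)

lemma inner_featureMean_discountedSum (P : Matrix 𝒮 𝒮 ℝ) (hP : P ∈ rowStochastic ℝ 𝒮)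
    {β : ℝ} (h0 : 0 ≤ β) (h1 : β < 1) (v : 𝒮 → ℝ) (w : EuclideanSpace ℝ (Fin K)) :
    HasSum (fun k : ℕ => β ^ k * ∑ s, π s * (valueApprox φ w s * ((P ^ k) *ᵥ v) s))
      (inner ℝ w (featureMean π φ (discountedSum P β v))) := by
  rw [inner_featureMean]
  have : ∀ s ∈ (Finset.univ : Finset 𝒮), HasSum
      (fun k : ℕ => π s * (valueApprox φ w s * (β ^ k * ((P ^ k) *ᵥ v) s)))
      (π s * (valueApprox φ w s * discountedSum P β v s)) := fun s _ =>
    ((summable_discounted hP h0 h1 v s).hasSum.mul_left _).mul_left _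
  convert hasSum_sum this using 2 with k
  rw [Finset.mul_sum]
  exact Finset.sum_congr rfl fun s _ => by ring

/-- TD(λ) is a gradient splitting of `f^(λ)`. -/
theorem inner_meanDirection_eq_neg_fLambda (hπ : IsStationary (transMatrix M μ) π)
    (h0 : 0 ≤ lam) (h1 : lam ≤ 1) {θstar : EuclideanSpace ℝ (Fin K)}
    (hstar : IsTDFixedPoint M μ π φ lam θstar) (θ : EuclideanSpace ℝ (Fin K)) :
    inner ℝ (θ - θstar) (meanDirection M μ π φ lam θ) =
      -fLambda (transMatrix M μ) π φ M.discount lam θstar θ := by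
  have hP := transMatrix_mem_rowStochastic M μ
  have hb1 := mul_discount_lt_one M h1
  have hb0 : 0 ≤ M.discount * lam := mul_nonneg M.discount_pos.le h0
  rw [← sub_zero (meanDirection M μ π φ lam θ), ← (hstar : meanDirection M μ π φ lam θstar = 0),
    meanDirection_sub M μ π φ h0 h1, bellmanError_sub, ← valueApprox_sub]
  have hsum := inner_featureMean_discountedSum (π := π) (φ := φ) (transMatrix M μ) hP hb0 hb1
    (M.discount • (transMatrix M μ *ᵥ valueApprox φ (θ - θstar)) - valueApprox φ (θ - θstar))
    (θ - θstar)
  rw [fLambda, ← valueApprox_sub]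
  set V := valueApprox φ (θ - θstar)
  set P := transMatrix M μ
  set γ := M.discount
  -- Both sides are expressed through the stationary autocorrelations ⟨V, P^k V⟩_D.
  set c : ℕ → ℝ := fun k => ∑ s, π s * (V s * ((P ^ k) *ᵥ V) s) with hc
  have hc0 : normDSq π V = c 0 := by simp [hc, normDSq, sq]
  have hcB : ∃ B, ∀ k, |c k| ≤ B := by
    obtain ⟨B, hB⟩ := exists_abs_le V
    refine ⟨B * B, fun k => abs_sum_mul_le hπ.nonneg hπ.sum_eq_one fun s => ?_⟩
    rw [abs_mul]
    exact mul_le_mul (hB s) (abs_mulVec_le (pow_mem hP k) hB s) (abs_nonneg _)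
      ((abs_nonneg _).trans (hB s))
  obtain ⟨B, hB⟩ := hcB
  have hs0 : Summable fun k => (γ * lam) ^ k * c k := summable_geometric_mul hb0 hb1 hB
  have hs1 : Summable fun k => (γ * lam) ^ k * c (k + 1) :=
    summable_geometric_mul hb0 hb1 fun k => hB (k + 1)
  have hterm : ∀ k : ℕ,
      (γ * lam) ^ k * ∑ s, π s * (V s * ((P ^ k) *ᵥ (γ • (P *ᵥ V) - V)) s) =
        γ * ((γ * lam) ^ k * c (k + 1)) - (γ * lam) ^ k * c k := fun k => by
    have : ∑ s, π s * (V s * ((P ^ k) *ᵥ (γ • (P *ᵥ V) - V)) s) = γ * c (k + 1) - c k := by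
      simp_rw [hc, Finset.mul_sum, ← Finset.sum_sub_distrib, mulVec_sub, mulVec_smul,
        mulVec_mulVec, ← pow_succ]
      refine Finset.sum_congr rfl fun s _ => ?_
      simp only [Pi.sub_apply, Pi.smul_apply, smul_eq_mul]
      ring
    rw [this]
    ring
  simp_rw [hterm] at hsum
  rw [hsum.unique ((hs1.hasSum.mul_left γ).sub hs0.hasSum)]
  have hdir : ∀ k : ℕ, lam ^ k * γ ^ (k + 1) * dirSq P π (k + 1) V =
      γ * c 0 * (γ * lam) ^ k - γ * ((γ * lam) ^ k * c (k + 1)) := fun k => by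
    rw [dirSq_eq hP hπ, hc0]
    ring
  simp_rw [hdir]
  rw [((summable_geometric_of_lt_one hb0 hb1).mul_left (γ * c 0)).tsum_sub (hs1.mul_left γ),
    tsum_mul_left, tsum_mul_left, tsum_geometric_of_lt_one hb0 hb1, hs0.tsum_eq_zero_add, hc0,
    kappa]
  -- With s = ∑ (γλ)^k c (k+1), the left side is γs - c 0 - γλs. The Dirichlet series contributes γκ
  -- c 0 - (1-λ)γs to f^(λ), and the coefficient 1 - γκ is what cancels the extra γκ c 0.
  have hshift : ∀ k : ℕ, (γ * lam) ^ (k + 1) * c (k + 1) =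
      (γ * lam) * ((γ * lam) ^ k * c (k + 1)) := fun k => by ring
  simp_rw [hshift, tsum_mul_left]
  have hne : 1 - γ * lam ≠ 0 := by linarith
  field_simp
  ring

lemma fLambda_convexOn (hπ : IsStationary (transMatrix M μ) π)
    (h0 : 0 ≤ lam) (h1 : lam ≤ 1) (θstar : EuclideanSpace ℝ (Fin K)) :
    ConvexOn ℝ Set.univ (fLambda (transMatrix M μ) π φ M.discount lam θstar) := by
  have hP := transMatrix_mem_rowStochastic M μ
  have hb1 := mul_discount_lt_one M h1
  have hb0 : 0 ≤ M.discount * lam := mul_nonneg M.discount_pos.le h0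
  refine ⟨convex_univ, fun x _ y _ a b ha hb hab => ?_⟩
  have hv : valueApprox φ (a • x + b • y) - valueApprox φ θstar =
      a • (valueApprox φ x - valueApprox φ θstar) + b • (valueApprox φ y - valueApprox φ θstar) := by
    ext s
    simp only [valueApprox_eq_inner, Pi.sub_apply, Pi.add_apply, Pi.smul_apply, smul_eq_mul,
      inner_add_left, real_inner_smul_left]
    linear_combination (inner ℝ θstar (φ s)) * hab
  simp only [fLambda, hv, smul_eq_mul]
  set V := valueApprox φ x - valueApprox φ θstar
  set W := valueApprox φ y - valueApprox φ θstar
  set γ := M.discount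
  have hγ0 : 0 ≤ γ := M.discount_pos.le
  -- γκ ≤ 1 amounts to γ(1 - λ) ≤ 1 - γλ, that is, γ ≤ 1.
  have hk : 0 ≤ 1 - γ * kappa γ lam := by
    rw [kappa, ← mul_div_assoc, sub_nonneg, div_le_one (by linarith)]
    nlinarith [M.discount_lt_one]
  have hsum : ∀ U : 𝒮 → ℝ, Summable fun m : ℕ =>
      lam ^ m * γ ^ (m + 1) * dirSq (transMatrix M μ) π (m + 1) U := fun U => by
    obtain ⟨B, hB⟩ := abs_dirSq_le hP hπ U
    refine ((summable_geometric_mul hb0 hb1 fun k => hB (k + 1)).mul_left γ).congr fun k => ?_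
    ring
  have ht := ((hsum (a • V + b • W)).tsum_le_tsum fun m => ?_)
    (((hsum V).mul_left a).add ((hsum W).mul_left b))
  rotate_left
  · have := mul_le_mul_of_nonneg_left (dirSq_convex hP hπ (m + 1) V W ha hb hab)
      (mul_nonneg (pow_nonneg h0 m) (pow_nonneg hγ0 (m + 1)))
    refine this.trans_eq ?_
    show _ = a * _ + b * _
    ring
  rw [((hsum V).mul_left a).tsum_add ((hsum W).mul_left b), tsum_mul_left, tsum_mul_left] at ht
  have hn := normDSq_convex hπ V W ha hb hab
  nlinarith [mul_le_mul_of_nonneg_left ht (sub_nonneg.2 h1), mul_le_mul_of_nonneg_left hn hk]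

end MeanDirection

/-! ### Functions of the finite history. -/

section History

variable {𝒮 𝒜 Ω β : Type*} {S : ℕ → Ω → 𝒮} {A : ℕ → Ω → 𝒜}

/-- `F` depends only on the states up to time `n` and on the actions before time `n`. -/
def IsHistoryFun (S : ℕ → Ω → 𝒮) (A : ℕ → Ω → 𝒜) (n : ℕ) (F : Ω → β) : Prop :=
  ∀ ω ω', (∀ i ≤ n, S i ω = S i ω') → (∀ i < n, A i ω = A i ω') → F ω = F ω'

/-- The history of the process up to time `n`. -/
def history (S : ℕ → Ω → 𝒮) (A : ℕ → Ω → 𝒜) (n : ℕ) (ω : Ω) : (Fin (n + 1) → 𝒮) × (Fin n → 𝒜) :=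
  (fun i => S i ω, fun i => A i ω)

lemma IsHistoryFun.mono {n n' : ℕ} {F : Ω → β} (h : IsHistoryFun S A n F) (hn : n ≤ n') :
    IsHistoryFun S A n' F := fun ω ω' hs ha =>
  h ω ω' (fun i hi => hs i (hi.trans hn)) fun i hi => ha i (hi.trans_le hn)

lemma isHistoryFun_state {i n : ℕ} (hi : i ≤ n) : IsHistoryFun S A n (S i) :=
  fun _ _ hs _ => hs i hi

lemma IsHistoryFun.comp {γ : Type*} {n : ℕ} {F : Ω → β} (h : IsHistoryFun S A n F) (g : β → γ) :
    IsHistoryFun S A n fun ω => g (F ω) := fun ω ω' hs ha => congrArg g (h ω ω' hs ha)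

lemma IsHistoryFun.comp₂ {γ δ : Type*} {n : ℕ} {F : Ω → β} {G : Ω → γ}
    (hF : IsHistoryFun S A n F) (hG : IsHistoryFun S A n G) (g : β → γ → δ) :
    IsHistoryFun S A n fun ω => g (F ω) (G ω) := fun ω ω' hs ha =>
  congrArg₂ g (hF ω ω' hs ha) (hG ω ω' hs ha)

/-- Reduces expectations to sums over finitely many histories; the value 0 given to unattained
histories is immaterial. -/
lemma IsHistoryFun.eq_comp {n : ℕ} {F : Ω → ℝ} (h : IsHistoryFun S A n F) :
    ∃ f : (Fin (n + 1) → 𝒮) × (Fin n → 𝒜) → ℝ, ∀ ω, F ω = f (history S A n ω) := by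
  have hf : Function.FactorsThrough F (history S A n) := fun ω ω' hω => by
    rw [history, history, Prod.mk.injEq] at hω
    exact h ω ω' (fun i hi => congrFun hω.1 ⟨i, Nat.lt_succ_of_le hi⟩)
      fun i hi => congrFun hω.2 ⟨i, hi⟩
  exact ⟨Function.extend (history S A n) F 0, fun ω => (hf.extend_apply 0 ω).symm⟩

end History

/-! ### The Markov property from the finite-dimensional distributions. -/

section Markov

variable {𝒮 𝒜 : Type*} [Fintype 𝒮] [MeasurableSpace 𝒮] [MeasurableSingletonClass 𝒮]
  [Fintype 𝒜] [MeasurableSpace 𝒜] [MeasurableSingletonClass 𝒜]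
  {Ω : Type*} [MeasurableSpace Ω] {Pr : Measure Ω} [IsProbabilityMeasure Pr]
  {M : MDP 𝒮 𝒜} {μ : Policy 𝒮 𝒜} {π : 𝒮 → ℝ} {S : ℕ → Ω → 𝒮} {A : ℕ → Ω → 𝒜}

omit [MeasurableSingletonClass 𝒮] [MeasurableSingletonClass 𝒜] [IsProbabilityMeasure Pr] in
lemma IsTrajectory.measurable_history (hpath : IsTrajectory Pr M μ π S A) (n : ℕ) :
    Measurable (history S A n) :=
  Measurable.prodMk (measurable_pi_lambda (fun ω (i : Fin (n + 1)) => S i ω)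
      fun i => hpath.measurable_state i)
    (measurable_pi_lambda (fun ω (i : Fin n) => A i ω) fun i => hpath.measurable_action i)

/-- The history is measurable with finitely many values, so no measurability of `F` has to be
assumed. -/
lemma IsTrajectory.integrable (hpath : IsTrajectory Pr M μ π S A) {n : ℕ} {F : Ω → ℝ}
    (hF : IsHistoryFun S A n F) : Integrable F Pr := by
  obtain ⟨f, hf⟩ := hF.eq_comp
  have : F = f ∘ history S A n := funext hf
  rw [this]
  have hX := hpath.measurable_history n
  have := Measure.isProbabilityMeasure_map hX.aemeasurable (μ := Pr)
  exact (Integrable.of_finite (f := f)).comp_measurable hX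

/-- The event that action `a` is taken at time `n` and leads to the state `s'`. -/
def stepEvent (S : ℕ → Ω → 𝒮) (A : ℕ → Ω → 𝒜) (n : ℕ) (a : 𝒜) (s' : 𝒮) : Set Ω :=
  {ω | A n ω = a ∧ S (n + 1) ω = s'}

omit [IsProbabilityMeasure Pr] in
lemma IsTrajectory.measurableSet_stepEvent (hpath : IsTrajectory Pr M μ π S A) (n : ℕ) (a : 𝒜)
    (s' : 𝒮) : MeasurableSet (stepEvent S A n a s') :=
  (hpath.measurable_action n (measurableSet_singleton a)).inter
    (hpath.measurable_state (n + 1) (measurableSet_singleton s'))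

omit [MeasurableSingletonClass 𝒮] [MeasurableSingletonClass 𝒜] [IsProbabilityMeasure Pr] in
lemma IsTrajectory.measureReal_history_inter (hpath : IsTrajectory Pr M μ π S A) (n : ℕ)
    (h : (Fin (n + 1) → 𝒮) × (Fin n → 𝒜)) (a : 𝒜) (s' : 𝒮) :
    Pr.real (history S A n ⁻¹' {h} ∩ stepEvent S A n a s') =
      Pr.real (history S A n ⁻¹' {h}) *
        (μ.prob (h.1 (Fin.last n)) a * M.trans (h.1 (Fin.last n)) a s') := by
  -- `law` is stated for infinite sequences. Padding `h` with `s'` and `a` puts them at the indices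
  -- n + 1 and n, so one pair of sequences describes both events.
  set s : ℕ → 𝒮 := fun i => if hi : i < n + 1 then h.1 ⟨i, hi⟩ else s' with hs
  set b : ℕ → 𝒜 := fun i => if hi : i < n then h.2 ⟨i, hi⟩ else a with hb
  have hsn : s n = h.1 (Fin.last n) := by simp [hs, Fin.last]
  have hsn1 : s (n + 1) = s' := by simp [hs]
  have hbn : b n = a := by simp [hb]
  have hatom : history S A n ⁻¹' {h} =
      {ω | (∀ i ≤ n, S i ω = s i) ∧ ∀ i < n, A i ω = b i} := by
    ext ω
    simp only [Set.mem_preimage, Set.mem_singleton_iff, Set.mem_ofPred_eq, history, Prod.ext_iff,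
      funext_iff]
    refine and_congr ⟨fun H i hi => ?_, fun H i => ?_⟩ ⟨fun H i hi => ?_, fun H i => ?_⟩
    · have := Nat.lt_succ_of_le hi
      simp only [hs, dif_pos this]
      exact H ⟨i, this⟩
    · rw [H i (Nat.le_of_lt_succ i.2)]
      exact dif_pos i.2
    · simp only [hb, dif_pos hi]
      exact H ⟨i, hi⟩
    · rw [H i i.2]
      simp [hb, i.2]
  have hnext : history S A n ⁻¹' {h} ∩ stepEvent S A n a s' =
      {ω | (∀ i ≤ n + 1, S i ω = s i) ∧ ∀ i < n + 1, A i ω = b i} := by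
    rw [hatom]
    ext ω
    simp only [stepEvent, Set.mem_inter_iff, Set.mem_ofPred_eq, Nat.lt_succ_iff_lt_or_eq,
      Nat.le_succ_iff, or_imp, forall_and, forall_eq, hsn1, hbn]
    tauto
  rw [hnext, hatom, hpath.law, hpath.law, Finset.prod_range_succ, hsn, hsn1, hbn, mul_assoc]

/-- Both sides split over the atoms of the history, on which `F` and the current state are constant.
-/
lemma IsTrajectory.integral_mul_indicator (hpath : IsTrajectory Pr M μ π S A) {n : ℕ} {F : Ω → ℝ}
    (hF : IsHistoryFun S A n F) (a : 𝒜) (s' : 𝒮) :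
    ∫ ω, (stepEvent S A n a s').indicator F ω ∂Pr =
      ∫ ω, μ.prob (S n ω) a * M.trans (S n ω) a s' * F ω ∂Pr := by
  classical
  obtain ⟨f, hf⟩ := hF.eq_comp
  have hX := hpath.measurable_history n
  have hatom : ∀ h, MeasurableSet (history S A n ⁻¹' {h}) := fun h => hX (measurableSet_singleton h)
  have e1 : ∀ ω, (stepEvent S A n a s').indicator F ω =
      ∑ h, (history S A n ⁻¹' {h} ∩ stepEvent S A n a s').indicator (fun _ => f h) ω := fun ω => by
    by_cases hω : ω ∈ stepEvent S A n a s' <;>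
      simp [Set.indicator_apply, hω, hf, eq_comm]
  have e2 : ∀ ω, μ.prob (S n ω) a * M.trans (S n ω) a s' * F ω =
      ∑ h, (history S A n ⁻¹' {h}).indicator (fun _ =>
        μ.prob (h.1 (Fin.last n)) a * M.trans (h.1 (Fin.last n)) a s' * f h) ω := fun ω => by
    simp only [Set.indicator_apply, Set.mem_preimage, Set.mem_singleton_iff,
      Finset.sum_ite_eq, Finset.mem_univ, if_true, hf]
    rfl
  simp_rw [e1, e2]
  rw [integral_finsetSum _ fun h _ => (integrable_const _).indicator
      ((hatom h).inter (hpath.measurableSet_stepEvent n a s')),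
    integral_finsetSum _ fun h _ => (integrable_const _).indicator (hatom h)]
  refine Finset.sum_congr rfl fun h _ => ?_
  rw [integral_indicator_const _ ((hatom h).inter (hpath.measurableSet_stepEvent n a s')),
    integral_indicator_const _ (hatom h), hpath.measureReal_history_inter]
  simp only [smul_eq_mul]
  ring

/-- One step of the process, conditionally on the history. -/
lemma IsTrajectory.integral_step (hpath : IsTrajectory Pr M μ π S A) {n : ℕ} {G : Ω → 𝒜 → 𝒮 → ℝ}
    (hG : IsHistoryFun S A n G) :
    ∫ ω, G ω (A n ω) (S (n + 1) ω) ∂Pr =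
      ∫ ω, ∑ a, ∑ s', μ.prob (S n ω) a * M.trans (S n ω) a s' * G ω a s' ∂Pr := by
  classical
  have hGas : ∀ a s', IsHistoryFun S A n fun ω => G ω a s' := fun a s' => hG.comp fun g => g a s'
  have e : ∀ ω, G ω (A n ω) (S (n + 1) ω) =
      ∑ a, ∑ s', (stepEvent S A n a s').indicator (fun ω => G ω a s') ω := fun ω => by
    simp only [stepEvent, Set.indicator_apply, Set.mem_ofPred_eq, ite_and]
    simp
  simp_rw [e]
  have hi1 : ∀ a s', Integrable ((stepEvent S A n a s').indicator fun ω => G ω a s') Pr :=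
    fun a s' => (hpath.integrable (hGas a s')).indicator (hpath.measurableSet_stepEvent n a s')
  have hi2 : ∀ a s', Integrable
      (fun ω => μ.prob (S n ω) a * M.trans (S n ω) a s' * G ω a s') Pr := fun a s' =>
    hpath.integrable ((isHistoryFun_state le_rfl).comp₂ (hGas a s')
      fun s g => μ.prob s a * M.trans s a s' * g)
  rw [integral_finsetSum _ fun a _ => integrable_finsetSum _ fun s' _ => hi1 a s',
    integral_finsetSum _ fun a _ => integrable_finsetSum _ fun s' _ => hi2 a s']
  refine Finset.sum_congr rfl fun a _ => ?_
  rw [integral_finsetSum _ fun s' _ => hi1 a s', integral_finsetSum _ fun s' _ => hi2 a s']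
  exact Finset.sum_congr rfl fun s' _ => hpath.integral_mul_indicator (hGas a s') a s'

variable [DecidableEq 𝒮]

/-- The Markov property for the state process. -/
lemma IsTrajectory.integral_state_add (hpath : IsTrajectory Pr M μ π S A) {n : ℕ} (j : ℕ)
    {H : Ω → 𝒮 → ℝ} (hH : IsHistoryFun S A n H) :
    ∫ ω, H ω (S (n + j) ω) ∂Pr = ∫ ω, ((transMatrix M μ ^ j) *ᵥ H ω) (S n ω) ∂Pr := by
  induction j generalizing H with
  | zero => simp
  | succ j ih =>
    have h1 := hpath.integral_step (G := fun ω _ s' => H ω s')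
      ((hH.mono (Nat.le_add_right n j)).comp fun v _ s' => v s')
    rw [← add_assoc, h1]
    -- The last transition is absorbed into the test function: the induction hypothesis is used for
    -- P H in place of H, which is why `H` is generalized.
    have h2 := ih (hH.comp fun v => transMatrix M μ *ᵥ v)
    simp_rw [mulVec_mulVec, ← pow_succ] at h2
    rw [← h2]
    refine integral_congr_ae (ae_of_all _ fun ω => ?_)
    simp only [mulVec, dotProduct, transMatrix, of_apply, Finset.sum_mul]
    exact Finset.sum_comm

end Markov

/-! ### Euclidean projection onto a convex set. -/

section Projection

variable {K : ℕ} {C : Set (EuclideanSpace ℝ (Fin K))} {u p q : EuclideanSpace ℝ (Fin K)}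

lemma IsProj.inner_le_zero (hC : Convex ℝ C) (hp : IsProj C u p) (hq : q ∈ C) :
    inner ℝ (u - p) (q - p) ≤ 0 := by
  refine (norm_eq_iInf_iff_real_inner_le_zero hC hp.1).1 ?_ q hq
  have : Nonempty C := ⟨⟨p, hp.1⟩⟩
  exact le_antisymm (le_ciInf fun w => hp.2 w w.2)
    (ciInf_le ⟨0, by rintro _ ⟨w, rfl⟩; exact norm_nonneg _⟩ (⟨p, hp.1⟩ : C))

/-- Adding the variational inequalities at `p` and at `q` gives ‖q - p‖² ≤ 0. -/
lemma IsProj.eq (hC : Convex ℝ C) (hp : IsProj C u p) (hq : IsProj C u q) : p = q := by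
  have h1 := hp.inner_le_zero hC hq.1
  have h2 := hq.inner_le_zero hC hp.1
  have h3 : inner ℝ (u - p) (q - p) + inner ℝ (u - q) (p - q) = ‖q - p‖ ^ 2 := by
    rw [← neg_sub q p, inner_neg_right, ← sub_eq_add_neg, ← inner_sub_left,
      show u - p - (u - q) = q - p by abel, real_inner_self_eq_norm_sq]
  have h4 : ‖q - p‖ = 0 := by nlinarith [norm_nonneg (q - p)]
  exact (sub_eq_zero.1 (norm_eq_zero.1 h4)).symm

/-- The variational inequality makes the cross term in ‖(u - p) - (q - p)‖² nonnegative. -/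
lemma IsProj.norm_sub_le (hC : Convex ℝ C) (hp : IsProj C u p) (hq : q ∈ C) :
    ‖p - q‖ ≤ ‖u - q‖ := by
  have h1 := hp.inner_le_zero hC hq
  have h2 : ‖u - q‖ ^ 2 = ‖u - p‖ ^ 2 - 2 * inner ℝ (u - p) (q - p) + ‖p - q‖ ^ 2 := by
    rw [show u - q = (u - p) - (q - p) by abel, norm_sub_sq_real, norm_sub_rev q p]
  exact abs_le_of_sq_le_sq' (by nlinarith [sq_nonneg ‖u - p‖]) (norm_nonneg _) |>.2

open Classical in
/-- The projection of `u` onto `C` if it exists, and `θ0` otherwise. -/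
def projOr (C : Set (EuclideanSpace ℝ (Fin K))) (θ0 u : EuclideanSpace ℝ (Fin K)) :
    EuclideanSpace ℝ (Fin K) :=
  if h : ∃ p, IsProj C u p then h.choose else θ0

lemma projOr_mem {θ0 : EuclideanSpace ℝ (Fin K)} (h0 : θ0 ∈ C) : projOr C θ0 u ∈ C := by
  rw [projOr]
  split_ifs with h
  · exact h.choose_spec.1
  · exact h0

lemma IsProj.projOr_eq (hC : Convex ℝ C) (hp : IsProj C u p) (θ0 : EuclideanSpace ℝ (Fin K)) :
    projOr C θ0 u = p := by
  have h : ∃ p, IsProj C u p := ⟨p, hp⟩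
  rw [projOr, dif_pos h]
  exact h.choose_spec.eq hC hp

end Projection

/-! ### Bounds on the sampled TD(λ) direction. -/

section Direction

variable {𝒮 𝒜 : Type*} [Fintype 𝒮] {K : ℕ} {M : MDP 𝒮 𝒜}
  {φ : 𝒮 → EuclideanSpace ℝ (Fin K)} {lam : ℝ}

/-- The update direction `δ_t z_t` of TD(λ) along a sample path. -/
def direction (M : MDP 𝒮 𝒜) (φ : 𝒮 → EuclideanSpace ℝ (Fin K)) (lam : ℝ)
    (θ : EuclideanSpace ℝ (Fin K)) (s : ℕ → 𝒮) (a : ℕ → 𝒜) (t : ℕ) : EuclideanSpace ℝ (Fin K) :=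
  tdError M φ θ (s t) (a t) (s (t + 1)) • trace φ M.discount lam s t

lemma sum_geometric_le {β : ℝ} (h0 : 0 ≤ β) (h1 : β < 1) (n : ℕ) :
    ∑ k ∈ Finset.range n, β ^ k ≤ 1 / (1 - β) := by
  rw [one_div, ← tsum_geometric_of_lt_one h0 h1]
  exact (summable_geometric_of_lt_one h0 h1).sum_le_tsum _ fun k _ => pow_nonneg h0 k

lemma norm_trace_le (hφ : FeatureAssumption φ) {γ : ℝ} (h0 : 0 ≤ γ * lam) (h1 : γ * lam < 1)
    (s : ℕ → 𝒮) (t : ℕ) : ‖trace φ γ lam s t‖ ≤ 1 / (1 - γ * lam) := by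
  refine ((norm_sum_le _ _).trans (Finset.sum_le_sum fun k _ => ?_)).trans
    (sum_geometric_le h0 h1 (t + 1))
  rw [norm_smul, norm_pow, Real.norm_eq_abs, abs_of_nonneg h0]
  exact mul_le_of_le_one_right (pow_nonneg h0 k) (hφ.norm_le_one _)

lemma abs_tdError_le (hφ : FeatureAssumption φ) {rmax R : ℝ}
    (hr : ∀ s a s', |M.reward s a s'| ≤ rmax) {θ : EuclideanSpace ℝ (Fin K)} (hθ : ‖θ‖ ≤ R)
    (s : 𝒮) (a : 𝒜) (s' : 𝒮) : |tdError M φ θ s a s'| ≤ rmax + 2 * R := by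
  have h1 := (hφ.abs_valueApprox_le θ s).trans hθ
  have h2 := (hφ.abs_valueApprox_le θ s').trans hθ
  have h3 : |M.discount * valueApprox φ θ s'| ≤ R := by
    rw [abs_mul, abs_of_pos M.discount_pos]
    exact (mul_le_of_le_one_left (abs_nonneg _) M.discount_lt_one.le).trans h2
  rw [tdError]
  linarith [hr s a s', abs_sub (M.reward s a s' + M.discount * valueApprox φ θ s')
    (valueApprox φ θ s), abs_add_le (M.reward s a s') (M.discount * valueApprox φ θ s')]

lemma abs_tdError_sub_le (hφ : FeatureAssumption φ) (θ θ' : EuclideanSpace ℝ (Fin K))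
    (s : 𝒮) (a : 𝒜) (s' : 𝒮) :
    |tdError M φ θ s a s' - tdError M φ θ' s a s'| ≤ 2 * ‖θ - θ'‖ := by
  have e : tdError M φ θ s a s' - tdError M φ θ' s a s' =
      M.discount * valueApprox φ (θ - θ') s' - valueApprox φ (θ - θ') s := by
    simp only [tdError, valueApprox_sub, Pi.sub_apply]
    ring
  have h1 := hφ.abs_valueApprox_le (θ - θ') s
  have h2 := hφ.abs_valueApprox_le (θ - θ') s'
  have h3 : |M.discount * valueApprox φ (θ - θ') s'| ≤ ‖θ - θ'‖ := by
    rw [abs_mul, abs_of_pos M.discount_pos]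
    exact (mul_le_of_le_one_left (abs_nonneg _) M.discount_lt_one.le).trans h2
  rw [e]
  linarith [abs_sub (M.discount * valueApprox φ (θ - θ') s') (valueApprox φ (θ - θ') s)]

lemma norm_direction_le (hφ : FeatureAssumption φ) (h0 : 0 ≤ lam) (h1 : lam ≤ 1) {rmax R : ℝ}
    (hr : ∀ s a s', |M.reward s a s'| ≤ rmax) {θ : EuclideanSpace ℝ (Fin K)} (hθ : ‖θ‖ ≤ R)
    (s : ℕ → 𝒮) (a : ℕ → 𝒜) (t : ℕ) :
    ‖direction M φ lam θ s a t‖ ≤ gBound M.discount lam rmax R := by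
  have hd := abs_tdError_le hφ hr hθ (s t) (a t) (s (t + 1))
  rw [direction, norm_smul, Real.norm_eq_abs, gBound, ← mul_one_div]
  exact mul_le_mul hd (norm_trace_le hφ (mul_nonneg M.discount_pos.le h0)
    (mul_discount_lt_one M h1) s t) (norm_nonneg _) ((abs_nonneg _).trans hd)

lemma norm_direction_sub_le (hφ : FeatureAssumption φ) (h0 : 0 ≤ lam) (h1 : lam ≤ 1)
    (θ θ' : EuclideanSpace ℝ (Fin K)) (s : ℕ → 𝒮) (a : ℕ → 𝒜) (t : ℕ) :
    ‖direction M φ lam θ s a t - direction M φ lam θ' s a t‖ ≤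
      2 * ‖θ - θ'‖ / (1 - M.discount * lam) := by
  rw [direction, direction, ← sub_smul, norm_smul, Real.norm_eq_abs, ← mul_one_div]
  exact mul_le_mul (abs_tdError_sub_le hφ θ θ' _ _ _) (norm_trace_le hφ
    (mul_nonneg M.discount_pos.le h0) (mul_discount_lt_one M h1) s t) (norm_nonneg _)
    (by positivity)

lemma bellmanError_eq_sum [Fintype 𝒜] (M : MDP 𝒮 𝒜) (μ : Policy 𝒮 𝒜)
    (φ : 𝒮 → EuclideanSpace ℝ (Fin K)) (θ : EuclideanSpace ℝ (Fin K)) (s : 𝒮) :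
    bellmanError M μ (valueApprox φ θ) s =
      ∑ a, ∑ s', μ.prob s a * M.trans s a s' * tdError M φ θ s a s' := by
  have e1 : ∀ a s', μ.prob s a * M.trans s a s' * tdError M φ θ s a s' =
      μ.prob s a * M.trans s a s' * M.reward s a s' +
        M.discount * (μ.prob s a * M.trans s a s' * valueApprox φ θ s') -
        μ.prob s a * (M.trans s a s' * valueApprox φ θ s) := fun a s' => by
    rw [tdError]
    ring
  simp_rw [e1, Finset.sum_sub_distrib, Finset.sum_add_distrib, ← Finset.mul_sum, ← Finset.sum_mul,
    M.trans_sum, one_mul, ← Finset.sum_mul, μ.prob_sum, one_mul]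
  simp only [bellmanError, Pi.sub_apply, Pi.add_apply, Pi.smul_apply, smul_eq_mul, rewardVec,
    mulVec, dotProduct, transMatrix, of_apply, Finset.sum_mul]
  rw [Finset.sum_comm, Finset.sum_comm (f := fun s' a =>
    μ.prob s a * M.trans s a s' * valueApprox φ θ s')]

lemma abs_bellmanError_le [Fintype 𝒜] {μ : Policy 𝒮 𝒜} {θ : EuclideanSpace ℝ (Fin K)} {B : ℝ}
    (hB : ∀ s a s', |tdError M φ θ s a s'| ≤ B) (s : 𝒮) :
    |bellmanError M μ (valueApprox φ θ) s| ≤ B := by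
  rw [bellmanError_eq_sum]
  simp_rw [mul_assoc, ← Finset.mul_sum]
  exact abs_sum_mul_le (μ.prob_nonneg s) (μ.prob_sum s) fun a =>
    abs_sum_mul_le (M.trans_nonneg s a) (M.trans_sum s a) (hB s a)

lemma inner_direction (w θ : EuclideanSpace ℝ (Fin K)) (s : ℕ → 𝒮) (a : ℕ → 𝒜) (t : ℕ) :
    inner ℝ w (direction M φ lam θ s a t) = ∑ k ∈ Finset.range (t + 1),
      (M.discount * lam) ^ k *
        (valueApprox φ w (s (t - k)) * tdError M φ θ (s t) (a t) (s (t + 1))) := by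
  simp_rw [direction, trace, inner_smul_right, inner_sum, inner_smul_right, Finset.mul_sum,
    valueApprox_eq_inner]
  exact Finset.sum_congr rfl fun k _ => by ring

end Direction

/-! ### A version of the iterates adapted to the history. -/

section Iterate

variable {𝒮 𝒜 Ω : Type*} [Fintype 𝒮] {K : ℕ} {M : MDP 𝒮 𝒜}
  {φ : 𝒮 → EuclideanSpace ℝ (Fin K)} {lam : ℝ} {C : Set (EuclideanSpace ℝ (Fin K))}
  {α : ℕ → ℝ} {θ0 : EuclideanSpace ℝ (Fin K)} {S : ℕ → Ω → 𝒮} {A : ℕ → Ω → 𝒜}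

/-- A version of the projected TD(λ) iterates that is everywhere a function of the history. -/
def tdIterate (M : MDP 𝒮 𝒜) (φ : 𝒮 → EuclideanSpace ℝ (Fin K)) (lam : ℝ)
    (C : Set (EuclideanSpace ℝ (Fin K))) (α : ℕ → ℝ) (θ0 : EuclideanSpace ℝ (Fin K))
    (S : ℕ → Ω → 𝒮) (A : ℕ → Ω → 𝒜) : ℕ → Ω → EuclideanSpace ℝ (Fin K)
  | 0, _ => θ0
  | t + 1, ω => projOr C θ0 (tdIterate M φ lam C α θ0 S A t ω +
      α t • direction M φ lam (tdIterate M φ lam C α θ0 S A t ω) (fun i => S i ω)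
        (fun i => A i ω) t)

lemma tdIterate_mem (h0 : θ0 ∈ C) (t : ℕ) (ω : Ω) : tdIterate M φ lam C α θ0 S A t ω ∈ C := by
  cases t with
  | zero => exact h0
  | succ t => exact projOr_mem h0

omit [Fintype 𝒮] in
lemma trace_congr (φ : 𝒮 → EuclideanSpace ℝ (Fin K)) (γ lam : ℝ) {s s' : ℕ → 𝒮} {t : ℕ}
    (h : ∀ i ≤ t, s i = s' i) : trace φ γ lam s t = trace φ γ lam s' t :=
  Finset.sum_congr rfl fun k _ => by rw [h _ (Nat.sub_le t k)]

lemma IsHistoryFun.direction {θ : Ω → EuclideanSpace ℝ (Fin K)} {n t : ℕ}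
    (hθ : IsHistoryFun S A n θ) (hn : n ≤ t + 1) :
    IsHistoryFun S A (t + 1) fun ω =>
      direction M φ lam (θ ω) (fun i => S i ω) (fun i => A i ω) t := fun ω ω' hs ha => by
  simp only [TDLambda.direction]
  rw [hθ.mono hn ω ω' hs ha, hs t (Nat.le_succ t), hs (t + 1) le_rfl, ha t (Nat.lt_succ_self t),
    trace_congr φ M.discount lam fun i hi => hs i (hi.trans (Nat.le_succ t))]

lemma isHistoryFun_tdIterate (t : ℕ) :
    IsHistoryFun S A t (tdIterate M φ lam C α θ0 S A t) := by
  induction t with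
  | zero => exact fun _ _ _ _ => rfl
  | succ t ih =>
    exact (ih.mono (Nat.le_succ t)).comp₂ (ih.direction (Nat.le_succ t))
      fun θ x => projOr C θ0 (θ + α t • x)

variable [MeasurableSpace Ω] {Pr : Measure Ω} {θ : ℕ → Ω → EuclideanSpace ℝ (Fin K)}

/-- Almost surely the projection exists at each step by assumption, and it is unique by convexity;
the default value in `projOr` is thus never used there. -/
lemma IsProjectedTD.ae_eq_tdIterate (hC : Convex ℝ C)
    (h : IsProjectedTD Pr M φ lam C α θ0 S A θ) :
    ∀ᵐ ω ∂Pr, ∀ t, θ t ω = tdIterate M φ lam C α θ0 S A t ω := by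
  filter_upwards [h.start, h.step] with ω h0 hs t
  induction t with
  | zero => exact h0
  | succ t ih =>
    have := hs t
    rw [mul_smul] at this
    rw [tdIterate, ← ih]
    exact (this.projOr_eq hC θ0).symm

lemma IsProjectedTD.ae_isProj (hC : Convex ℝ C)
    (h : IsProjectedTD Pr M φ lam C α θ0 S A θ) :
    ∀ᵐ ω ∂Pr, ∀ t, IsProj C (tdIterate M φ lam C α θ0 S A t ω +
      α t • direction M φ lam (tdIterate M φ lam C α θ0 S A t ω) (fun i => S i ω)
        (fun i => A i ω) t) (tdIterate M φ lam C α θ0 S A (t + 1) ω) := by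
  filter_upwards [h.ae_eq_tdIterate hC, h.step] with ω he hs t
  have := hs t
  rwa [mul_smul, he, he] at this

end Iterate

/-! ### Mixing times, truncation of the trace and decoupling. -/

lemma abs_tsum_sub_sum_range_le {β : ℝ} (h0 : 0 ≤ β) (h1 : β < 1) {c : ℕ → ℝ} {B : ℝ}
    (hc : ∀ k, |c k| ≤ B) (n : ℕ) :
    |∑' k, β ^ k * c k - ∑ k ∈ Finset.range n, β ^ k * c k| ≤ β ^ n * (B / (1 - β)) := by
  rw [← (summable_geometric_mul h0 h1 hc).sum_add_tsum_nat_add n, add_sub_cancel_left]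
  have e : ∀ k, β ^ (k + n) * c (k + n) = β ^ n * (β ^ k * c (k + n)) := fun k => by ring
  simp_rw [e]
  rw [tsum_mul_left, abs_mul, abs_of_nonneg (pow_nonneg h0 n)]
  exact mul_le_mul_of_nonneg_left (abs_tsum_geometric_mul_le h0 h1 fun k => hc (k + n))
    (pow_nonneg h0 n)

/-- Since ρ < 1 the set defining `tauMC` is nonempty, so its infimum is attained; monotonicity of
ρ^t gives the later times. -/
lemma mul_pow_le_of_tauMC_le {m ρ ε : ℝ} (hm : 0 ≤ m) (h0 : 0 ≤ ρ) (h1 : ρ < 1) (hε : 0 < ε)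
    {t : ℕ} (ht : tauMC m ρ ε ≤ t) : m * ρ ^ t ≤ ε := by
  have hlim := (tendsto_pow_atTop_nhds_zero_of_lt_one h0 h1).const_mul m
  rw [mul_zero] at hlim
  have hne : {t : ℕ | m * ρ ^ t ≤ ε}.Nonempty :=
    ((hlim.eventually (gt_mem_nhds hε)).mono fun _ h => h.le).exists
  exact (mul_le_mul_of_nonneg_left (pow_le_pow_of_le_one h0 h1.le ht) hm).trans (Nat.sInf_mem hne)

lemma pow_le_of_tauAlgo_le {γ lam ε : ℝ} (h0 : 0 ≤ γ * lam) (h1 : γ * lam < 1) (hε : 0 < ε)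
    {t : ℕ} (ht : tauAlgo γ lam ε ≤ t) : (γ * lam) ^ t ≤ ε := by
  have := mul_pow_le_of_tauMC_le zero_le_one h0 h1 hε (t := t)
  simp only [tauMC, one_mul] at this
  exact this ht

lemma isHistoryFun_corr {𝒮 𝒜 Ω : Type*} [Fintype 𝒮] {K : ℕ} {M : MDP 𝒮 𝒜}
    {S : ℕ → Ω → 𝒮} {A : ℕ → Ω → 𝒜} {φ : 𝒮 → EuclideanSpace ℝ (Fin K)}
    {Y : Ω → EuclideanSpace ℝ (Fin K)} {θstar : EuclideanSpace ℝ (Fin K)} {p : ℕ}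
    (hY : IsHistoryFun S A p Y) (j k : ℕ) :
    IsHistoryFun S A (p + j + k + 1) fun ω => valueApprox φ (Y ω - θstar) (S (p + j) ω) *
      tdError M φ (Y ω) (S (p + j + k) ω) (A (p + j + k) ω) (S (p + j + k + 1) ω) :=
    fun ω ω' hs ha => by
  have := hY.mono (show p ≤ p + j + k + 1 by omega) ω ω' hs ha
  simp only
  rw [this, hs (p + j) (by omega), hs (p + j + k) (by omega), hs _ le_rfl,
    ha (p + j + k) (by omega)]

section Decoupling

variable {𝒮 𝒜 : Type*} [Fintype 𝒮] [DecidableEq 𝒮] [MeasurableSpace 𝒮]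
  [MeasurableSingletonClass 𝒮] [Fintype 𝒜] [MeasurableSpace 𝒜] [MeasurableSingletonClass 𝒜]
  {Ω : Type*} [MeasurableSpace Ω] {Pr : Measure Ω} [IsProbabilityMeasure Pr] {K : ℕ}
  {M : MDP 𝒮 𝒜} {μ : Policy 𝒮 𝒜} {π : 𝒮 → ℝ} {S : ℕ → Ω → 𝒮} {A : ℕ → Ω → 𝒜}
  {φ : 𝒮 → EuclideanSpace ℝ (Fin K)} {lam m ρ : ℝ} {Y : Ω → EuclideanSpace ℝ (Fin K)}
  {θstar : EuclideanSpace ℝ (Fin K)}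

/-- The stationary mean of the `k`-th summand of the TD(λ) direction, in the direction `w`. -/
def stationaryCorr (M : MDP 𝒮 𝒜) (μ : Policy 𝒮 𝒜) (π : 𝒮 → ℝ)
    (φ : 𝒮 → EuclideanSpace ℝ (Fin K)) (w θ : EuclideanSpace ℝ (Fin K)) (k : ℕ) : ℝ :=
  ∑ s, π s * (valueApprox φ w s *
    ((transMatrix M μ ^ k) *ᵥ bellmanError M μ (valueApprox φ θ)) s)

omit [MeasurableSpace 𝒮] [MeasurableSingletonClass 𝒮] [MeasurableSpace 𝒜]
  [MeasurableSingletonClass 𝒜] in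
lemma abs_corr_le (hφ : FeatureAssumption φ) {w θ : EuclideanSpace ℝ (Fin K)} {L D : ℝ}
    (hL : ‖w‖ ≤ L) (hD : ∀ s a s', |tdError M φ θ s a s'| ≤ D) (k : ℕ) (s : 𝒮) :
    |valueApprox φ w s * ((transMatrix M μ ^ k) *ᵥ bellmanError M μ (valueApprox φ θ)) s| ≤
      L * D := by
  rw [abs_mul]
  exact mul_le_mul ((hφ.abs_valueApprox_le w s).trans hL)
    (abs_mulVec_le (pow_mem (transMatrix_mem_rowStochastic M μ) k) (abs_bellmanError_le hD) s)
    (abs_nonneg _) ((norm_nonneg w).trans hL)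

/-- Three successive conditionings: the last action and transition turn the TD error into the
Bellman error, then k steps lead back to time p + j, then j steps back to time p, where `Y` is
already determined. -/
lemma IsTrajectory.integral_corr (hpath : IsTrajectory Pr M μ π S A) {p : ℕ}
    (hY : IsHistoryFun S A p Y) (j k : ℕ) :
    ∫ ω, valueApprox φ (Y ω - θstar) (S (p + j) ω) *
        tdError M φ (Y ω) (S (p + j + k) ω) (A (p + j + k) ω) (S (p + j + k + 1) ω) ∂Pr =
      ∫ ω, ((transMatrix M μ ^ j) *ᵥ fun s => valueApprox φ (Y ω - θstar) s *
        ((transMatrix M μ ^ k) *ᵥ bellmanError M μ (valueApprox φ (Y ω))) s) (S p ω) ∂Pr := by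
  have hYj := hY.mono (Nat.le_add_right p j)
  have hYS : IsHistoryFun S A (p + j) fun ω => (Y ω, S (p + j) ω) :=
    hYj.comp₂ (isHistoryFun_state le_rfl) Prod.mk
  have h1 := hpath.integral_step (n := p + j + k)
    (G := fun ω a s' => valueApprox φ (Y ω - θstar) (S (p + j) ω) *
      tdError M φ (Y ω) (S (p + j + k) ω) a s')
    ((hYS.mono (Nat.le_add_right _ k)).comp₂ (isHistoryFun_state le_rfl)
      fun y s a s' => valueApprox φ (y.1 - θstar) y.2 * tdError M φ y.1 s a s')
  have h2 := hpath.integral_state_add k (n := p + j)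
    (H := fun ω s => valueApprox φ (Y ω - θstar) (S (p + j) ω) *
      bellmanError M μ (valueApprox φ (Y ω)) s)
    (hYS.comp fun y s => valueApprox φ (y.1 - θstar) y.2 * bellmanError M μ (valueApprox φ y.1) s)
  have h3 := hpath.integral_state_add j (n := p)
    (H := fun ω s => valueApprox φ (Y ω - θstar) s *
      ((transMatrix M μ ^ k) *ᵥ bellmanError M μ (valueApprox φ (Y ω))) s)
    (hY.comp fun y s => valueApprox φ (y - θstar) s *
      ((transMatrix M μ ^ k) *ᵥ bellmanError M μ (valueApprox φ y)) s)
  rw [h1, ← h3]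
  refine Eq.trans (Eq.trans (integral_congr_ae (ae_of_all _ fun ω => ?_)) h2)
    (integral_congr_ae (ae_of_all _ fun ω => ?_))
  · simp only [bellmanError_eq_sum, Finset.mul_sum]
    exact Finset.sum_congr rfl fun a _ => Finset.sum_congr rfl fun s' _ => by ring
  · exact congrFun (mulVec_smul (transMatrix M μ ^ k)
      (valueApprox φ (Y ω - θstar) (S (p + j) ω)) (bellmanError M μ (valueApprox φ (Y ω)))) _

/-- After conditioning, P^j acts on a function bounded by L D whose π-mean is `stationaryCorr`;
mixing over j steps compares the two. -/
lemma IsTrajectory.abs_integral_corr_sub_le (hpath : IsTrajectory Pr M μ π S A)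
    (hmix : IsMixing (transMatrix M μ) π m ρ) (hφ : FeatureAssumption φ) {p : ℕ}
    (hY : IsHistoryFun S A p Y) {L D : ℝ} (hL0 : 0 ≤ L) (hD0 : 0 ≤ D)
    (hL : ∀ ω, ‖Y ω - θstar‖ ≤ L) (hD : ∀ ω s a s', |tdError M φ (Y ω) s a s'| ≤ D) (j k : ℕ) :
    |∫ ω, (valueApprox φ (Y ω - θstar) (S (p + j) ω) *
        tdError M φ (Y ω) (S (p + j + k) ω) (A (p + j + k) ω) (S (p + j + k + 1) ω) -
        stationaryCorr M μ π φ (Y ω - θstar) (Y ω) k) ∂Pr| ≤ 2 * (m * ρ ^ j) * (L * D) := by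
  have hb : IsHistoryFun S A p fun ω => stationaryCorr M μ π φ (Y ω - θstar) (Y ω) k :=
    hY.comp fun y => stationaryCorr M μ π φ (y - θstar) y k
  have hg : IsHistoryFun S A p fun ω => ((transMatrix M μ ^ j) *ᵥ fun s =>
      valueApprox φ (Y ω - θstar) s *
        ((transMatrix M μ ^ k) *ᵥ bellmanError M μ (valueApprox φ (Y ω))) s) (S p ω) :=
    hY.comp₂ (isHistoryFun_state le_rfl) fun y s => ((transMatrix M μ ^ j) *ᵥ fun s =>
      valueApprox φ (y - θstar) s *
        ((transMatrix M μ ^ k) *ᵥ bellmanError M μ (valueApprox φ y)) s) s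
  rw [integral_sub (hpath.integrable (isHistoryFun_corr hY j k))
    (hpath.integrable hb), hpath.integral_corr hY,
    ← integral_sub (hpath.integrable hg) (hpath.integrable hb)]
  rw [← Real.norm_eq_abs]
  refine (norm_integral_le_of_norm_le_const (ae_of_all _ fun ω => ?_)).trans_eq
    (by rw [probReal_univ, mul_one])
  exact hmix.abs_mulVec_sub_le (mul_nonneg hL0 hD0)
    (fun s => abs_corr_le hφ (hL ω) (hD ω) k s) j (S p ω)

omit [MeasurableSpace 𝒮] [MeasurableSingletonClass 𝒮] [MeasurableSpace 𝒜]
  [MeasurableSingletonClass 𝒜] in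
/-- Truncation of the eligibility trace. -/
lemma inner_direction_sub_meanDirection_le (hπ : IsStationary (transMatrix M μ) π)
    (hφ : FeatureAssumption φ) (h0 : 0 ≤ lam) (h1 : lam ≤ 1)
    {w θ : EuclideanSpace ℝ (Fin K)} {L D : ℝ} (hL : ‖w‖ ≤ L)
    (hD : ∀ s a s', |tdError M φ θ s a s'| ≤ D) (s : ℕ → 𝒮) (a : ℕ → 𝒜) {n t : ℕ}
    (hn : n ≤ t + 1) :
    inner ℝ w (direction M φ lam θ s a t - meanDirection M μ π φ lam θ) ≤
      ∑ k ∈ Finset.range n, (M.discount * lam) ^ k *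
        (valueApprox φ w (s (t - k)) * tdError M φ θ (s t) (a t) (s (t + 1)) -
          stationaryCorr M μ π φ w θ k) +
      2 * ((M.discount * lam) ^ n * (L * D / (1 - M.discount * lam))) := by
  have hb1 := mul_discount_lt_one M h1
  have hb0 : 0 ≤ M.discount * lam := mul_nonneg M.discount_pos.le h0
  set β := M.discount * lam
  have hb : ∀ k, |stationaryCorr M μ π φ w θ k| ≤ L * D := fun k =>
    abs_sum_mul_le hπ.nonneg hπ.sum_eq_one (abs_corr_le hφ hL hD k)
  have hmean : inner ℝ w (meanDirection M μ π φ lam θ) =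
      ∑' k, β ^ k * stationaryCorr M μ π φ w θ k := by
    rw [meanDirection_eq M μ π φ h0 h1]
    exact (inner_featureMean_discountedSum _ (transMatrix_mem_rowStochastic M μ) hb0 hb1 _
      w).tsum_eq.symm
  -- The finite trace is padded with zeros, so that it becomes a series with coefficients bounded by
  -- L D, like the series for the mean direction.
  set c : ℕ → ℝ := fun k => if k < t + 1 then
    valueApprox φ w (s (t - k)) * tdError M φ θ (s t) (a t) (s (t + 1)) else 0 with hc
  have hLD : 0 ≤ L * D := (abs_nonneg _).trans (hb 0)
  have hcB : ∀ k, |c k| ≤ L * D := fun k => by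
    simp only [hc]
    split_ifs
    · rw [abs_mul]
      exact mul_le_mul ((hφ.abs_valueApprox_le w _).trans hL) (hD _ _ _) (abs_nonneg _)
        ((norm_nonneg w).trans hL)
    · simpa using hLD
  have hdir : inner ℝ w (direction M φ lam θ s a t) = ∑' k, β ^ k * c k := by
    rw [inner_direction, tsum_eq_sum (s := Finset.range (t + 1)) fun k hk => by
      simp only [hc, if_neg (mt Finset.mem_range.2 hk), mul_zero]]
    exact Finset.sum_congr rfl fun k hk => by simp only [hc, if_pos (Finset.mem_range.1 hk)]; rfl
  have hsum : ∑ k ∈ Finset.range n, β ^ k *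
      (valueApprox φ w (s (t - k)) * tdError M φ θ (s t) (a t) (s (t + 1)) -
        stationaryCorr M μ π φ w θ k) =
      ∑ k ∈ Finset.range n, β ^ k * c k -
        ∑ k ∈ Finset.range n, β ^ k * stationaryCorr M μ π φ w θ k := by
    rw [← Finset.sum_sub_distrib]
    refine Finset.sum_congr rfl fun k hk => ?_
    simp only [hc, if_pos ((Finset.mem_range.1 hk).trans_le hn), mul_sub]
  -- One tail from the sample and one from the mean: hence the factor 2.
  have t1 := (abs_le.1 (abs_tsum_sub_sum_range_le hb0 hb1 hcB n)).2
  have t2 := (abs_le.1 (abs_tsum_sub_sum_range_le hb0 hb1 hb n)).1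
  rw [inner_sub_right, hmean, hdir, hsum]
  linarith

/-- A parameter that is determined `2τ` steps in advance is nearly unbiased. -/
lemma IsTrajectory.integral_inner_direction_sub_le (hpath : IsTrajectory Pr M μ π S A)
    (hπ : IsStationary (transMatrix M μ) π) (hmix : IsMixing (transMatrix M μ) π m ρ)
    (hm : 0 ≤ m) (hρ0 : 0 ≤ ρ) (hρ1 : ρ < 1) (hφ : FeatureAssumption φ) (h0 : 0 ≤ lam)
    (h1 : lam ≤ 1) {p : ℕ} (hY : IsHistoryFun S A p Y) {L D ε : ℝ} (hL0 : 0 ≤ L) (hD0 : 0 ≤ D)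
    (hL : ∀ ω, ‖Y ω - θstar‖ ≤ L) (hD : ∀ ω s a s', |tdError M φ (Y ω) s a s'| ≤ D)
    (hε : 0 < ε) {τ : ℕ} (hτ : tauMix m ρ M.discount lam ε ≤ τ) :
    ∫ ω, inner ℝ (Y ω - θstar) (direction M φ lam (Y ω) (fun i => S i ω) (fun i => A i ω)
        (p + 2 * τ) - meanDirection M μ π φ lam (Y ω)) ∂Pr ≤
      4 * ε * (L * D / (1 - M.discount * lam)) := by
  have hb1 := mul_discount_lt_one M h1
  have hb0 : 0 ≤ M.discount * lam := mul_nonneg M.discount_pos.le h0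
  have hLD := mul_nonneg hL0 hD0
  have hint : ∀ k ∈ Finset.range (τ + 1), Integrable (fun ω => (M.discount * lam) ^ k *
      (valueApprox φ (Y ω - θstar) (S (p + 2 * τ - k) ω) *
        tdError M φ (Y ω) (S (p + 2 * τ) ω) (A (p + 2 * τ) ω) (S (p + 2 * τ + 1) ω) -
        stationaryCorr M μ π φ (Y ω - θstar) (Y ω) k)) Pr := fun k hk => by
    have hk := Finset.mem_range.1 hk
    obtain ⟨j, hj⟩ : ∃ j, p + 2 * τ = p + j + k := ⟨2 * τ - k, by omega⟩
    rw [hj, Nat.add_sub_cancel]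
    exact ((hpath.integrable (isHistoryFun_corr hY j k)).sub (hpath.integrable
      (hY.comp fun y => stationaryCorr M μ π φ (y - θstar) y k))).const_mul _
  have hle : ∀ k ∈ Finset.range (τ + 1), ∫ ω, (M.discount * lam) ^ k *
      (valueApprox φ (Y ω - θstar) (S (p + 2 * τ - k) ω) *
        tdError M φ (Y ω) (S (p + 2 * τ) ω) (A (p + 2 * τ) ω) (S (p + 2 * τ + 1) ω) -
        stationaryCorr M μ π φ (Y ω - θstar) (Y ω) k) ∂Pr ≤
      (M.discount * lam) ^ k * (2 * ε * (L * D)) := fun k hk => by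
    have hk := Finset.mem_range.1 hk
    -- The state at lag k ≤ τ lies j = 2τ - k ≥ τ steps after time p, which is enough for mixing to
    -- level ε.
    obtain ⟨j, hj⟩ : ∃ j, p + 2 * τ = p + j + k := ⟨2 * τ - k, by omega⟩
    rw [hj, Nat.add_sub_cancel, integral_const_mul]
    refine mul_le_mul_of_nonneg_left ?_ (pow_nonneg hb0 k)
    refine (le_abs_self _).trans
      ((hpath.abs_integral_corr_sub_le hmix hφ hY hL0 hD0 hL hD j k).trans ?_)
    have := mul_pow_le_of_tauMC_le hm hρ0 hρ1 hε (t := j)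
      ((le_max_left _ _).trans (hτ.trans (by omega)))
    gcongr
  have hpow : (M.discount * lam) ^ (τ + 1) ≤ ε :=
    pow_le_of_tauAlgo_le hb0 hb1 hε ((le_max_right _ _).trans (hτ.trans (Nat.le_succ τ)))
  have hq : 0 ≤ L * D / (1 - M.discount * lam) := div_nonneg hLD (by linarith)
  have hhist : IsHistoryFun S A (p + 2 * τ + 1) fun ω => inner ℝ (Y ω - θstar)
      (direction M φ lam (Y ω) (fun i => S i ω) (fun i => A i ω) (p + 2 * τ) -
        meanDirection M μ π φ lam (Y ω)) :=
    (hY.mono (by omega)).comp₂ (hY.direction (t := p + 2 * τ) (by omega))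
      fun y x => inner ℝ (y - θstar) (x - meanDirection M μ π φ lam y)
  calc _ ≤ ∫ ω, (∑ k ∈ Finset.range (τ + 1), (M.discount * lam) ^ k *
      (valueApprox φ (Y ω - θstar) (S (p + 2 * τ - k) ω) *
        tdError M φ (Y ω) (S (p + 2 * τ) ω) (A (p + 2 * τ) ω) (S (p + 2 * τ + 1) ω) -
        stationaryCorr M μ π φ (Y ω - θstar) (Y ω) k) +
      2 * ((M.discount * lam) ^ (τ + 1) * (L * D / (1 - M.discount * lam)))) ∂Pr :=
        integral_mono (hpath.integrable hhist)
          ((integrable_finsetSum _ hint).add (integrable_const _)) fun ω =>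
          inner_direction_sub_meanDirection_le hπ hφ h0 h1 (hL ω) (hD ω) (fun i => S i ω)
            (fun i => A i ω) (by omega)
    _ ≤ ∑ k ∈ Finset.range (τ + 1), (M.discount * lam) ^ k * (2 * ε * (L * D)) +
        2 * (ε * (L * D / (1 - M.discount * lam))) := by
      rw [integral_add (integrable_finsetSum _ hint) (integrable_const _),
        integral_finsetSum _ hint, integral_const, probReal_univ, one_smul]
      exact add_le_add (Finset.sum_le_sum hle) (by gcongr)
    _ ≤ 1 / (1 - M.discount * lam) * (2 * ε * (L * D)) +
        2 * (ε * (L * D / (1 - M.discount * lam))) := by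
      rw [← Finset.sum_mul]
      gcongr
      exact sum_geometric_le hb0 hb1 _
    _ = 4 * ε * (L * D / (1 - M.discount * lam)) := by ring

end Decoupling

/-! ### Size and Lipschitz constant of the noise. -/

lemma inner_sub_inner_le {E : Type*} [NormedAddCommGroup E] [InnerProductSpace ℝ E]
    {w w' x x' : E} {a b c : ℝ} (hx : ‖x‖ ≤ a) (hw : ‖w'‖ ≤ b) (hxx : ‖x - x'‖ ≤ c) :
    |inner ℝ w x - inner ℝ w' x'| ≤ ‖w - w'‖ * a + b * c := by
  have e : inner ℝ w x - inner ℝ w' x' = inner ℝ (w - w') x + inner ℝ w' (x - x') := by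
    rw [inner_sub_left, inner_sub_right]
    ring
  rw [e]
  refine (abs_add_le _ _).trans (add_le_add ?_ ?_)
  · exact (abs_real_inner_le_norm _ _).trans (mul_le_mul_of_nonneg_left hx (norm_nonneg _))
  · exact (abs_real_inner_le_norm _ _).trans
      (mul_le_mul hw hxx (norm_nonneg _) ((norm_nonneg _).trans hw))

lemma two_mul_le_gBound {𝒮 𝒜 : Type*} [Fintype 𝒮] (M : MDP 𝒮 𝒜) {lam rmax R : ℝ} (h0 : 0 ≤ lam) (h1 : lam ≤ 1) (hr0 : 0 ≤ rmax)
    (hR0 : 0 ≤ R) : 2 * R / (1 - M.discount * lam) ≤ gBound M.discount lam rmax R ∧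
      2 * R ≤ gBound M.discount lam rmax R := by
  have hb1 := mul_discount_lt_one M h1
  have hb0 : 0 ≤ M.discount * lam := mul_nonneg M.discount_pos.le h0
  have hpos : 0 < 1 - M.discount * lam := by linarith
  have h : 2 * R / (1 - M.discount * lam) ≤ gBound M.discount lam rmax R := by
    rw [gBound]
    gcongr
    linarith
  exact ⟨h, (le_div_self (by positivity) hpos (by linarith)).trans h⟩

section Noise

variable {𝒮 𝒜 : Type*} [Fintype 𝒮] [DecidableEq 𝒮] [Fintype 𝒜] {K : ℕ}
  {M : MDP 𝒮 𝒜} {μ : Policy 𝒮 𝒜} {π : 𝒮 → ℝ} {φ : 𝒮 → EuclideanSpace ℝ (Fin K)} {lam : ℝ}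
  {θ θ' θstar : EuclideanSpace ℝ (Fin K)} {rmax R : ℝ}

/-- The inner product of the error `θ - θ*` with the noise in the TD(λ) direction. -/
def noise (M : MDP 𝒮 𝒜) (μ : Policy 𝒮 𝒜) (π : 𝒮 → ℝ) (φ : 𝒮 → EuclideanSpace ℝ (Fin K))
    (lam : ℝ) (θstar θ : EuclideanSpace ℝ (Fin K)) (s : ℕ → 𝒮) (a : ℕ → 𝒜) (t : ℕ) : ℝ :=
  inner ℝ (θ - θstar) (direction M φ lam θ s a t - meanDirection M μ π φ lam θ)

lemma norm_meanDirection_le_gBound (hπ : IsStationary (transMatrix M μ) π)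
    (hφ : FeatureAssumption φ) (h0 : 0 ≤ lam) (h1 : lam ≤ 1)
    (hr : ∀ s a s', |M.reward s a s'| ≤ rmax) (hθ : ‖θ‖ ≤ R) :
    ‖meanDirection M μ π φ lam θ‖ ≤ gBound M.discount lam rmax R :=
  norm_meanDirection_le hπ hφ h0 h1 (abs_bellmanError_le (abs_tdError_le hφ hr hθ))

lemma norm_direction_sub_meanDirection_le (hπ : IsStationary (transMatrix M μ) π)
    (hφ : FeatureAssumption φ) (h0 : 0 ≤ lam) (h1 : lam ≤ 1)
    (hr : ∀ s a s', |M.reward s a s'| ≤ rmax) (hθ : ‖θ‖ ≤ R) (s : ℕ → 𝒮) (a : ℕ → 𝒜) (t : ℕ) :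
    ‖direction M φ lam θ s a t - meanDirection M μ π φ lam θ‖ ≤
      2 * gBound M.discount lam rmax R := by
  rw [two_mul]
  exact (norm_sub_le _ _).trans (add_le_add (norm_direction_le hφ h0 h1 hr hθ s a t)
    (norm_meanDirection_le_gBound hπ hφ h0 h1 hr hθ))

lemma abs_noise_le (hπ : IsStationary (transMatrix M μ) π)
    (hφ : FeatureAssumption φ) (h0 : 0 ≤ lam) (h1 : lam ≤ 1) (hr0 : 0 ≤ rmax)
    (hr : ∀ s a s', |M.reward s a s'| ≤ rmax) (hθ : ‖θ‖ ≤ R) (hs : ‖θstar‖ ≤ R)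
    (s : ℕ → 𝒮) (a : ℕ → 𝒜) (t : ℕ) :
    |noise M μ π φ lam θstar θ s a t| ≤ 2 * gBound M.discount lam rmax R ^ 2 := by
  have hG := (two_mul_le_gBound M h0 h1 hr0 ((norm_nonneg _).trans hθ)).2
  have hx := norm_direction_sub_meanDirection_le hπ hφ h0 h1 hr hθ s a t
  have hw : ‖θ - θstar‖ ≤ gBound M.discount lam rmax R :=
    (norm_sub_le _ _).trans (by linarith)
  calc _ ≤ ‖θ - θstar‖ * ‖direction M φ lam θ s a t - meanDirection M μ π φ lam θ‖ :=
        abs_real_inner_le_norm _ _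
    _ ≤ gBound M.discount lam rmax R * (2 * gBound M.discount lam rmax R) :=
        mul_le_mul hw hx (norm_nonneg _) ((norm_nonneg _).trans hw)
    _ = _ := by ring

lemma noise_lipschitz (hπ : IsStationary (transMatrix M μ) π)
    (hφ : FeatureAssumption φ) (h0 : 0 ≤ lam) (h1 : lam ≤ 1) (hr0 : 0 ≤ rmax)
    (hr : ∀ s a s', |M.reward s a s'| ≤ rmax) (hθ : ‖θ‖ ≤ R) (hθ' : ‖θ'‖ ≤ R) (hs : ‖θstar‖ ≤ R)
    (s : ℕ → 𝒮) (a : ℕ → 𝒜) (t : ℕ) :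
    |noise M μ π φ lam θstar θ s a t - noise M μ π φ lam θstar θ' s a t| ≤
      6 * gBound M.discount lam rmax R * ‖θ - θ'‖ := by
  have hG := (two_mul_le_gBound M h0 h1 hr0 ((norm_nonneg _).trans hθ)).1
  have hw : ‖θ' - θstar‖ ≤ 2 * R := (norm_sub_le _ _).trans (by linarith)
  have hxx : ‖(direction M φ lam θ s a t - meanDirection M μ π φ lam θ) -
      (direction M φ lam θ' s a t - meanDirection M μ π φ lam θ')‖ ≤
      2 * (2 * ‖θ - θ'‖ / (1 - M.discount * lam)) := by
    rw [sub_sub_sub_comm, two_mul (2 * ‖θ - θ'‖ / _)]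
    exact (norm_sub_le _ _).trans (add_le_add (norm_direction_sub_le hφ h0 h1 θ θ' s a t)
      (norm_meanDirection_sub_le hπ hφ h0 h1 θ θ'))
  refine (inner_sub_inner_le (norm_direction_sub_meanDirection_le hπ hφ h0 h1 hr hθ s a t)
    hw hxx).trans ?_
  rw [sub_sub_sub_cancel_right]
  -- The constant 6 is 2 + 4: the change of θ - θ* meets a vector of norm at most 2G, and the change
  -- of direction contributes 4 · 2R/(1 - γλ) ≤ 4G.
  have e : 2 * R * (2 * (2 * ‖θ - θ'‖ / (1 - M.discount * lam))) =
      4 * (2 * R / (1 - M.discount * lam)) * ‖θ - θ'‖ := by ring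
  rw [e]
  nlinarith [mul_le_mul_of_nonneg_right hG (norm_nonneg (θ - θ'))]

lemma isHistoryFun_noise {Ω : Type*} {S : ℕ → Ω → 𝒮} {A : ℕ → Ω → 𝒜} {Z : Ω → EuclideanSpace ℝ (Fin K)} {n t : ℕ}
    (hZ : IsHistoryFun S A n Z) (hn : n ≤ t + 1) :
    IsHistoryFun S A (t + 1) fun ω =>
      noise M μ π φ lam θstar (Z ω) (fun i => S i ω) (fun i => A i ω) t :=
  (hZ.mono hn).comp₂ (hZ.direction hn)
    fun y x => inner ℝ (y - θstar) (x - meanDirection M μ π φ lam y)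

end Noise

/-! ### Expected noise, expected progress and averaging. -/

section Convergence

variable {𝒮 𝒜 : Type*} [Fintype 𝒮] [DecidableEq 𝒮] [MeasurableSpace 𝒮]
  [MeasurableSingletonClass 𝒮] [Fintype 𝒜] [MeasurableSpace 𝒜] [MeasurableSingletonClass 𝒜]
  {Ω : Type*} [MeasurableSpace Ω] {Pr : Measure Ω} [IsProbabilityMeasure Pr] {K : ℕ}
  {M : MDP 𝒮 𝒜} {μ : Policy 𝒮 𝒜} {π : 𝒮 → ℝ} {S : ℕ → Ω → 𝒮} {A : ℕ → Ω → 𝒜}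
  {φ : 𝒮 → EuclideanSpace ℝ (Fin K)} {lam m ρ rmax R : ℝ} {Y : ℕ → Ω → EuclideanSpace ℝ (Fin K)}
  {θstar : EuclideanSpace ℝ (Fin K)}

/-- The expected noise along a slowly varying adapted sequence. -/
lemma IsTrajectory.integral_noise_le (hpath : IsTrajectory Pr M μ π S A)
    (hπ : IsStationary (transMatrix M μ) π) (hmix : IsMixing (transMatrix M μ) π m ρ)
    (hm : 0 ≤ m) (hρ0 : 0 ≤ ρ) (hρ1 : ρ < 1) (hφ : FeatureAssumption φ) (h0 : 0 ≤ lam)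
    (h1 : lam ≤ 1) (hr0 : 0 ≤ rmax) (hr : ∀ s a s', |M.reward s a s'| ≤ rmax)
    (hY : ∀ t, IsHistoryFun S A t (Y t)) (hYR : ∀ t ω, ‖Y t ω‖ ≤ R) (hs : ‖θstar‖ ≤ R)
    {ε : ℝ} (hε : 0 < ε) {t : ℕ}
    (hstep : ∀ᵐ ω ∂Pr, ∀ i < t, ‖Y (i + 1) ω - Y i ω‖ ≤ ε * gBound M.discount lam rmax R)
    (ht : 2 * tauMix m ρ M.discount lam ε ≤ t) :
    ∫ ω, noise M μ π φ lam θstar (Y t ω) (fun i => S i ω) (fun i => A i ω) t ∂Pr ≤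
      gBound M.discount lam rmax R ^ 2 *
        (ε * (12 * (tauMix m ρ M.discount lam ε : ℝ) + 4)) := by
  set τ := tauMix m ρ M.discount lam ε with hτ
  set G := gBound M.discount lam rmax R with hGdef
  obtain ⟨p, hp⟩ : ∃ p, t = p + 2 * τ := ⟨t - 2 * τ, by omega⟩
  have hR0 : 0 ≤ R := (norm_nonneg _).trans hs
  have hG := two_mul_le_gBound M h0 h1 hr0 hR0
  have hG0 : 0 ≤ G := by linarith [hG.2]
  -- Drift over the 2τ steps since the freezing time; multiplied by the Lipschitz constant 6G it
  -- produces the 12τ.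
  have hdist : ∀ᵐ ω ∂Pr, ‖Y t ω - Y p ω‖ ≤ 2 * τ * (ε * G) := by
    filter_upwards [hstep] with ω hω
    have : ∀ j, p + j ≤ t → ‖Y (p + j) ω - Y p ω‖ ≤ j * (ε * G) := fun j => by
      induction j with
      | zero => simp
      | succ j ih =>
        intro hj
        have := norm_sub_le_norm_sub_add_norm_sub (Y (p + j + 1) ω) (Y (p + j) ω) (Y p ω)
        have h2 := ih (by omega)
        have h3 := hω (p + j) (by omega)
        rw [← add_assoc]
        push_cast
        linarith
    rw [hp]
    simpa using this (2 * τ) hp.ge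
  have hdec := hpath.integral_inner_direction_sub_le (φ := φ) (θstar := θstar) hπ hmix hm hρ0 hρ1
    hφ h0 h1 (hY p) (L := 2 * R) (D := rmax + 2 * R) (by positivity) (by positivity)
    (fun ω => (norm_sub_le _ _).trans (by linarith [hYR p ω]))
    (fun ω => abs_tdError_le hφ hr (hYR p ω)) hε le_rfl
  rw [← hτ, ← hp] at hdec
  have hi1 := hpath.integrable (isHistoryFun_noise (M := M) (μ := μ) (π := π) (φ := φ)
    (lam := lam) (θstar := θstar) (t := t) (hY t) (by omega))
  have hi2 := hpath.integrable (isHistoryFun_noise (M := M) (μ := μ) (π := π) (φ := φ)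
    (lam := lam) (θstar := θstar) (t := t) (hY p) (by omega))
  have hmono : ∫ ω, noise M μ π φ lam θstar (Y t ω) (fun i => S i ω) (fun i => A i ω) t ∂Pr ≤
      ∫ ω, (noise M μ π φ lam θstar (Y p ω) (fun i => S i ω) (fun i => A i ω) t +
        6 * G * (2 * τ * (ε * G))) ∂Pr := by
    refine integral_mono_ae hi1 (hi2.add (integrable_const _)) ?_
    filter_upwards [hdist] with ω hω
    have := (abs_le.1 (noise_lipschitz (M := M) (μ := μ) hπ hφ h0 h1 hr0 hr (hYR t ω) (hYR p ω) hs
      (fun i => S i ω) (fun i => A i ω) t)).2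
    have h3 := mul_le_mul_of_nonneg_left hω (mul_nonneg (by norm_num : (0:ℝ) ≤ 6) hG0)
    linarith
  rw [integral_add hi2 (integrable_const _), integral_const, probReal_univ, one_smul] at hmono
  have hC : 2 * R * (rmax + 2 * R) / (1 - M.discount * lam) ≤ G ^ 2 := by
    rw [mul_div_assoc, sq]
    exact mul_le_mul_of_nonneg_right hG.2 hG0
  have hfin : 4 * ε * (2 * R * (rmax + 2 * R) / (1 - M.discount * lam)) ≤ 4 * ε * G ^ 2 := by
    gcongr
  refine hmono.trans ((add_le_add_left (hdec.trans hfin) _).trans_eq ?_)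
  ring

/-- The expected progress of projected stochastic gradient splitting with constant step-size. -/
lemma IsTrajectory.sum_integral_fLambda_le (hpath : IsTrajectory Pr M μ π S A)
    (hπ : IsStationary (transMatrix M μ) π) (hφ : FeatureAssumption φ) (h0 : 0 ≤ lam)
    (h1 : lam ≤ 1) (hr : ∀ s a s', |M.reward s a s'| ≤ rmax)
    (hstar : IsTDFixedPoint M μ π φ lam θstar)
    (hY : ∀ t, IsHistoryFun S A t (Y t)) (hYR : ∀ t ω, ‖Y t ω‖ ≤ R) {α : ℝ} {T : ℕ}
    (hstep : ∀ᵐ ω ∂Pr, ∀ t < T, ‖Y (t + 1) ω - θstar‖ ≤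
      ‖Y t ω + α • direction M φ lam (Y t ω) (fun i => S i ω) (fun i => A i ω) t - θstar‖) :
    2 * α * ∑ t ∈ Finset.range T,
        ∫ ω, fLambda (transMatrix M μ) π φ M.discount lam θstar (Y t ω) ∂Pr ≤
      ∫ ω, ‖Y 0 ω - θstar‖ ^ 2 ∂Pr + T * (α ^ 2 * gBound M.discount lam rmax R ^ 2) +
      2 * α * ∑ t ∈ Finset.range T,
        ∫ ω, noise M μ π φ lam θstar (Y t ω) (fun i => S i ω) (fun i => A i ω) t ∂Pr := by
  have hiX : ∀ t, Integrable (fun ω => ‖Y t ω - θstar‖ ^ 2) Pr := fun t =>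
    hpath.integrable ((hY t).comp fun y => ‖y - θstar‖ ^ 2)
  have hif : ∀ t, Integrable
      (fun ω => fLambda (transMatrix M μ) π φ M.discount lam θstar (Y t ω)) Pr := fun t =>
    hpath.integrable ((hY t).comp _)
  have hin : ∀ t, Integrable (fun ω =>
      noise M μ π φ lam θstar (Y t ω) (fun i => S i ω) (fun i => A i ω) t) Pr := fun t =>
    hpath.integrable (isHistoryFun_noise (hY t) (Nat.le_succ t))
  have hone : ∀ t < T, ∫ ω, ‖Y (t + 1) ω - θstar‖ ^ 2 ∂Pr ≤
      ∫ ω, ‖Y t ω - θstar‖ ^ 2 ∂Pr + 2 * α *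
        (∫ ω, noise M μ π φ lam θstar (Y t ω) (fun i => S i ω) (fun i => A i ω) t ∂Pr -
        ∫ ω, fLambda (transMatrix M μ) π φ M.discount lam θstar (Y t ω) ∂Pr) +
      α ^ 2 * gBound M.discount lam rmax R ^ 2 := fun t ht => by
    have hc : ∫ _ω, α ^ 2 * gBound M.discount lam rmax R ^ 2 ∂Pr =
        α ^ 2 * gBound M.discount lam rmax R ^ 2 := by
      rw [integral_const, probReal_univ, one_smul]
    have hi1 : Integrable (fun ω => 2 * α *
        (noise M μ π φ lam θstar (Y t ω) (fun i => S i ω) (fun i => A i ω) t -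
          fLambda (transMatrix M μ) π φ M.discount lam θstar (Y t ω))) Pr :=
      ((hin t).sub (hif t)).const_mul (2 * α)
    have hi2 : Integrable (fun ω => ‖Y t ω - θstar‖ ^ 2 + 2 * α *
        (noise M μ π φ lam θstar (Y t ω) (fun i => S i ω) (fun i => A i ω) t -
          fLambda (transMatrix M μ) π φ M.discount lam θstar (Y t ω))) Pr := (hiX t).add hi1
    rw [← integral_sub (hin t) (hif t), ← integral_const_mul, ← integral_add (hiX t) hi1, ← hc,
      ← integral_add hi2 (integrable_const _)]
    refine integral_mono_ae (hiX (t + 1)) (hi2.add (integrable_const _)) ?_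
    filter_upwards [hstep] with ω hω
    have hx := norm_direction_le hφ h0 h1 hr (hYR t ω) (fun i => S i ω) (fun i => A i ω) t
    have hsq := pow_le_pow_left₀ (norm_nonneg _) (hω t ht) 2
    have hm := inner_meanDirection_eq_neg_fLambda hπ h0 h1 hstar (Y t ω)
    have hxsq := mul_le_mul_of_nonneg_left (pow_le_pow_left₀ (norm_nonneg _) hx 2) (sq_nonneg α)
    -- In the expanded square, the cross term is 2α times noise minus f^(λ), by gradient splitting.
    rw [add_sub_right_comm, norm_add_sq_real, inner_smul_right, norm_smul, mul_pow,
      Real.norm_eq_abs, sq_abs] at hsq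
    simp only [noise, inner_sub_right, hm]
    linarith
  have hind : ∀ n ≤ T, ∫ ω, ‖Y n ω - θstar‖ ^ 2 ∂Pr ≤
      ∫ ω, ‖Y 0 ω - θstar‖ ^ 2 ∂Pr + n * (α ^ 2 * gBound M.discount lam rmax R ^ 2) +
      2 * α * ∑ t ∈ Finset.range n,
        ∫ ω, noise M μ π φ lam θstar (Y t ω) (fun i => S i ω) (fun i => A i ω) t ∂Pr -
      2 * α * ∑ t ∈ Finset.range n,
        ∫ ω, fLambda (transMatrix M μ) π φ M.discount lam θstar (Y t ω) ∂Pr := fun n => by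
    induction n with
    | zero => simp
    | succ n ih =>
      intro hn
      have h2 := ih (by omega)
      have h3 := hone n (by omega)
      rw [Finset.sum_range_succ, Finset.sum_range_succ]
      push_cast
      linarith
  -- The telescoped sum ends with the squared distance at time T, which is dropped.
  have hnn : 0 ≤ ∫ ω, ‖Y T ω - θstar‖ ^ 2 ∂Pr := integral_nonneg fun ω => sq_nonneg _
  linarith [hind T le_rfl]

omit [MeasurableSpace 𝒮] [MeasurableSingletonClass 𝒮] [MeasurableSpace 𝒜]
  [MeasurableSingletonClass 𝒜] in
lemma fLambda_average_le (hπ : IsStationary (transMatrix M μ) π) (h0 : 0 ≤ lam) (h1 : lam ≤ 1)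
    (θstar : EuclideanSpace ℝ (Fin K)) (θ : ℕ → EuclideanSpace ℝ (Fin K)) {T : ℕ} (hT : 1 ≤ T) :
    fLambda (transMatrix M μ) π φ M.discount lam θstar (average θ T) ≤
      1 / (T : ℝ) * ∑ t ∈ Finset.range T,
        fLambda (transMatrix M μ) π φ M.discount lam θstar (θ t) := by
  have hT0 : (T : ℝ) ≠ 0 := Nat.cast_ne_zero.2 (by omega)
  have := (fLambda_convexOn (φ := φ) hπ h0 h1 θstar).map_sum_le (t := Finset.range T)
    (w := fun _ => 1 / (T : ℝ)) (p := θ) (fun _ _ => by positivity) (by simp [hT0])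
    fun _ _ => Set.mem_univ _
  rwa [← Finset.smul_sum, ← Finset.smul_sum, smul_eq_mul] at this

end Convergence

lemma sum_range_ite_lt_le (T n : ℕ) {c : ℝ} (hc : 0 ≤ c) :
    ∑ t ∈ Finset.range T, (if t < n then c else 0) ≤ n * c := by
  rw [← Finset.sum_filter, Finset.sum_const, nsmul_eq_mul]
  gcongr
  calc _ ≤ (Finset.range n).card := Finset.card_le_card fun t ht => by
        simpa using (Finset.mem_filter.1 ht).2
    _ = n := Finset.card_range n

end TDLambda

end

/-! ### The convergence rate. -/

open TDLambda in
theorem corollary4 {𝒮 𝒜 : Type*} [Fintype 𝒮] [DecidableEq 𝒮] [MeasurableSpace 𝒮]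
    [MeasurableSingletonClass 𝒮] [Fintype 𝒜] [MeasurableSpace 𝒜] [MeasurableSingletonClass 𝒜]
    {K : ℕ} (M : TDLambda.MDP 𝒮 𝒜) (μ : TDLambda.Policy 𝒮 𝒜)
    (lam : ℝ) (hlam0 : 0 ≤ lam) (hlam1 : lam ≤ 1)
    (hirr : (TDLambda.transMatrix M μ).IsIrreducible)
    (haper : TDLambda.IsAperiodic (TDLambda.transMatrix M μ))
    (π : 𝒮 → ℝ) (hπ : TDLambda.IsStationary (TDLambda.transMatrix M μ) π)
    (m ρ : ℝ) (hm : 0 < m) (hρ0 : 0 < ρ) (hρ1 : ρ < 1)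
    (hmix : TDLambda.IsMixing (TDLambda.transMatrix M μ) π m ρ)
    (φ : 𝒮 → EuclideanSpace ℝ (Fin K)) (hφ : TDLambda.FeatureAssumption φ)
    (rmax : ℝ) (hrmax : ∀ s a s', |M.reward s a s'| ≤ rmax)
    (Θ : Set (EuclideanSpace ℝ (Fin K))) (hΘ : Convex ℝ Θ)
    (R : ℝ) (hR : ∀ θ ∈ Θ, ‖θ‖ ≤ R)
    (θstar : EuclideanSpace ℝ (Fin K))
    (hstar : TDLambda.IsTDFixedPoint M μ π φ lam θstar) (hstarΘ : θstar ∈ Θ)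
    {Ω : Type*} [MeasurableSpace Ω] (Pr : MeasureTheory.Measure Ω)
    [MeasureTheory.IsProbabilityMeasure Pr]
    (S : ℕ → Ω → 𝒮) (A : ℕ → Ω → 𝒜) (hpath : TDLambda.IsTrajectory Pr M μ π S A)
    (T : ℕ) (hT : 1 ≤ T) (α : ℕ → ℝ) (hα : ∀ t ≤ T, α t = 1 / √(T : ℝ))
    (θ0 : EuclideanSpace ℝ (Fin K)) (θ : ℕ → Ω → EuclideanSpace ℝ (Fin K))
    (hθ : TDLambda.IsProjectedTD Pr M φ lam Θ α θ0 S A θ) :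
    MeasureTheory.Integrable
        (fun ω => TDLambda.fLambda (TDLambda.transMatrix M μ) π φ M.discount lam θstar
          (TDLambda.average (fun t => θ t ω) T)) Pr ∧
      ∫ ω, TDLambda.fLambda (TDLambda.transMatrix M μ) π φ M.discount lam θstar
          (TDLambda.average (fun t => θ t ω) T) ∂Pr ≤
        (‖θstar - θ0‖ ^ 2 + TDLambda.gBound M.discount lam rmax R ^ 2 *
            (14 + 28 * (TDLambda.tauMix m ρ M.discount lam (1 / √(T : ℝ)) : ℝ))) /
          (2 * √(T : ℝ)) := by
  have hx : 0 < √(T : ℝ) := Real.sqrt_pos.2 (by exact_mod_cast hT)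
  have hxx : √(T : ℝ) ^ 2 = T := Real.sq_sqrt (Nat.cast_nonneg T)
  set x := √(T : ℝ) with hxdef
  have hε : 0 < 1 / x := by positivity
  have hs : ‖θstar‖ ≤ R := hR θstar hstarΘ
  -- Probabilities summing to 1 force states and actions to exist, so some |r| is bounded by `rmax`.
  have hr0 : 0 ≤ rmax := by
    obtain ⟨s⟩ : Nonempty 𝒮 := by
      by_contra h
      rw [not_nonempty_iff] at h
      simpa using hπ.sum_eq_one
    obtain ⟨a⟩ : Nonempty 𝒜 := by
      by_contra h
      rw [not_nonempty_iff] at h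
      simpa using μ.prob_sum s
    exact (abs_nonneg _).trans (hrmax s a s)
  set Y := tdIterate M φ lam Θ α θ0 S A with hYdef
  have hY : ∀ t, IsHistoryFun S A t (Y t) := isHistoryFun_tdIterate
  have hYΘ : ∀ t ω, Y t ω ∈ Θ := fun t ω => tdIterate_mem hθ.start_mem t ω
  have hYR : ∀ t ω, ‖Y t ω‖ ≤ R := fun t ω => hR _ (hYΘ t ω)
  set G := gBound M.discount lam rmax R with hG
  set τ := tauMix m ρ M.discount lam (1 / x) with hτ
  set f := fLambda (transMatrix M μ) π φ M.discount lam θstar with hf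
  have hproj : ∀ q ∈ Θ, ∀ᵐ ω ∂Pr, ∀ t < T, ‖Y (t + 1) ω - q‖ ≤ ‖Y t ω +
      (1 / x) • direction M φ lam (Y t ω) (fun i => S i ω) (fun i => A i ω) t - q‖ := fun q hq => by
    filter_upwards [hθ.ae_isProj hΘ] with ω hω t ht
    have := (hω t).norm_sub_le hΘ hq
    rwa [hα t ht.le] at this
  -- The current iterate itself lies in Θ, so projecting moves it no farther than the unprojected
  -- step.
  have hmove : ∀ᵐ ω ∂Pr, ∀ t < T, ‖Y (t + 1) ω - Y t ω‖ ≤ 1 / x * G := by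
    filter_upwards [hθ.ae_isProj hΘ] with ω hω t ht
    have := (hω t).norm_sub_le hΘ (hYΘ t ω)
    rw [hα t ht.le, add_sub_cancel_left, norm_smul, Real.norm_of_nonneg hε.le] at this
    exact this.trans (mul_le_mul_of_nonneg_left (norm_direction_le hφ hlam0 hlam1 hrmax (hYR t ω)
      (fun i => S i ω) (fun i => A i ω) t) hε.le)
  have hnoise : ∀ t ∈ Finset.range T,
      ∫ ω, noise M μ π φ lam θstar (Y t ω) (fun i => S i ω) (fun i => A i ω) t ∂Pr ≤
        -- Every time receives the late-time bound; early times get only an additional `x`, rather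
        -- than the whole crude bound 2G². This keeps the final coefficient of τ at 28.
        G ^ 2 * (1 / x * (12 * (τ : ℝ) + 4) + if t < 2 * τ then x else 0) := fun t ht => by
    split_ifs with htτ
    · have hτ1 : (1 : ℝ) ≤ τ := by exact_mod_cast (by omega : 1 ≤ τ)
      -- After multiplying by x this follows from x² + 1 ≥ 2x.
      have h2 : 2 ≤ 1 / x * (12 * (τ : ℝ) + 4) + x := by
        have : 1 / x * (12 * (τ : ℝ) + 4) + x = (12 * (τ : ℝ) + 4 + x ^ 2) / x := by
          field_simp
        rw [this, le_div_iff₀ hx]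
        nlinarith [sq_nonneg (x - 1)]
      have h3 : ∀ᵐ ω ∂Pr, ‖noise M μ π φ lam θstar (Y t ω) (fun i => S i ω) (fun i => A i ω) t‖ ≤
          2 * G ^ 2 := ae_of_all _ fun ω =>
        abs_noise_le hπ hφ hlam0 hlam1 hr0 hrmax (hYR t ω) hs _ _ t
      have h4 := (le_abs_self _).trans (norm_integral_le_of_norm_le_const h3)
      rw [probReal_univ, mul_one] at h4
      nlinarith [sq_nonneg G]
    · rw [add_zero]
      refine hpath.integral_noise_le hπ hmix hm.le hρ0.le hρ1 hφ hlam0 hlam1 hr0 hrmax hY hYR hs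
        hε ?_ (not_lt.1 htτ)
      filter_upwards [hmove] with ω hω i hi
      exact hω i (hi.trans (Finset.mem_range.1 ht))
  have hsumnoise : ∑ t ∈ Finset.range T,
      ∫ ω, noise M μ π φ lam θstar (Y t ω) (fun i => S i ω) (fun i => A i ω) t ∂Pr ≤
        G ^ 2 * (x * (14 * (τ : ℝ) + 4)) := by
    refine (Finset.sum_le_sum hnoise).trans ?_
    rw [← Finset.mul_sum, Finset.sum_add_distrib, Finset.sum_const, Finset.card_range,
      nsmul_eq_mul, ← hxx]
    refine mul_le_mul_of_nonneg_left ?_ (sq_nonneg G)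
    -- At most 2τ early times contribute x each, raising 12τ to 14τ.
    have h1 := sum_range_ite_lt_le T (2 * τ) hx.le
    push_cast at h1
    have h2 : x ^ 2 * (1 / x * (12 * (τ : ℝ) + 4)) = x * (12 * (τ : ℝ) + 4) := by
      field_simp
    rw [h2]
    linarith
  have hprog := hpath.sum_integral_fLambda_le hπ hφ hlam0 hlam1 hrmax hstar hY hYR
    (hproj θstar hstarΘ)
  have hY0 : ∫ ω, ‖Y 0 ω - θstar‖ ^ 2 ∂Pr = ‖θstar - θ0‖ ^ 2 := by
    simp only [hYdef, tdIterate]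
    rw [integral_const, probReal_univ, one_smul, norm_sub_rev]
  have hif : ∀ t, Integrable (fun ω => f (Y t ω)) Pr := fun t => hpath.integrable ((hY t).comp f)
  have havg : IsHistoryFun S A T fun ω => f (average (fun t => Y t ω) T) := fun ω ω' hs ha => by
    simp only [TDLambda.average]
    rw [Finset.sum_congr rfl fun t ht =>
      (hY t).mono (Finset.mem_range.1 ht).le ω ω' hs ha]
  have hae : (fun ω => f (average (fun t => Y t ω) T)) =ᵐ[Pr]
      fun ω => f (average (fun t => θ t ω) T) := by
    filter_upwards [hθ.ae_eq_tdIterate hΘ] with ω hω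
    simp only [hω, hYdef]
  refine ⟨(hpath.integrable havg).congr hae, ?_⟩
  rw [← integral_congr_ae hae]
  -- Jensen's inequality for the convex f^(λ), applied pathwise.
  have hjensen : ∫ ω, f (average (fun t => Y t ω) T) ∂Pr ≤
      1 / (T : ℝ) * ∑ t ∈ Finset.range T, ∫ ω, f (Y t ω) ∂Pr := by
    rw [← integral_finsetSum _ fun t _ => hif t, ← integral_const_mul]
    exact integral_mono (hpath.integrable havg)
      ((integrable_finsetSum _ fun t _ => hif t).const_mul _)
      fun ω => fLambda_average_le hπ hlam0 hlam1 θstar _ hT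
  refine hjensen.trans ?_
  rw [hY0, ← hxx] at hprog
  rw [← hxx, le_div_iff₀ (by positivity)]
  have e1 : x ^ 2 * ((1 / x) ^ 2 * G ^ 2) = G ^ 2 := by field_simp
  have e2 : 1 / x ^ 2 * (∑ t ∈ Finset.range T, ∫ ω, f (Y t ω) ∂Pr) * (2 * x) =
      2 * (1 / x) * ∑ t ∈ Finset.range T, ∫ ω, f (Y t ω) ∂Pr := by field_simp
  have e3 : 2 * (1 / x) * (G ^ 2 * (x * (14 * (τ : ℝ) + 4))) =
      G ^ 2 * (28 * (τ : ℝ) + 8) := by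
    field_simp
    ring
  have h5 := mul_le_mul_of_nonneg_left hsumnoise (by positivity : 0 ≤ 2 * (1 / x))
  rw [e1] at hprog
  rw [e2]
  rw [e3] at h5
  -- The τ-free multiples of G² are 1 from the squared steps and 8 from the noise, and 9 ≤ 14.
  nlinarith [sq_nonneg G]
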